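/- **Proposition 6.1.** Let $\mathcal S$ be a finite subset of $\mathbb Z^2$, with step polynomial $S(x,y)=\sum_{(i,j)\in\mathcal S}x^iy^j$. Assume that $\mathcal S$ is a *Hadamard model*: there are Laurent polynomials $U,V,T$ in one variable (over a field $\mathbb K$ of characteristic $0$) such that $$S(x,y)=U(x)+V(x)\,T(y).$$ Let $Q(x,y;t)=\sum_{i,j,n\ge 0}q(i,j;n)\,x^iy^jt^n\in\mathbb Q[[x,y,t]]$, where $q(i,j;n)$ is the number of $n$-step walks with steps in $\mathcal S$ that start at $(0,0)$, end at $(i,j)$ and remain in the quadrant $\mathbb N^2$, with $\mathbb N=\{0,1,2,\dots\}$. (1) Suppose that $U(x)=\sum_{i\in\mathcal U}x^i$, $V(x)=\sum_{i\in\mathcal V}x^i$ and $T(y)=\sum_{j\in\mathcal T}y^j$ for finite subsets $\mathcal U,\mathcal V,\mathcal T$ of $\mathbb Z$. Let $C_1(x,v;t)$ be the generating function of walks on $\mathbb N$ that start from $0$ and take steps in the multiset $\mathcal U\cup\mathcal V$ (steps in $\mathcal U\cap\mathcal V$ occur twice, once as an element of $\mathcal U$ and once as an element of $\mathcal V$),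 counted by the length ($t$), the endpoint ($x$) and the number of steps in $\mathcal V$ ($v$). Let $C_2(y;v)$ be the generating function of walks on $\mathbb N$ that start from $0$ and take steps in $\mathcal T$, counted by the length ($v$) and the endpoint ($y$). Then $C_1(x,v;t)$ and $C_2(y;v)$ are algebraic, and $$Q(x,y;t)=\left. C_1(x,v;t)\odot_v C_2(y;v)\right|_{v=1},$$ where $\odot_v$ is the Hadamard product in $v$, defined by $\left(\sum_n a_nv^n\right)\odot_v\left(\sum_n b_nv^n\right)=\sum_n a_nb_nv^n$. Here the evaluation at $v=1$ is well defined: for each monomial $x^iy^jt^n$, only finitely many powers of $v$ contribute to its coefficient. (2) The series $Q(x,y;t)$ is D-finite. A power series is *algebraic* if it is a root of a non-zero polynomial with coefficients in the ring of polynomials over $\mathbb Q$ in the variables of the series. A power series $F$ is *D-finite* if, for each of its variables $z$, the iterated derivatives $\partial_z^mF$, $m\ge 0$, span a finite-dimensional vector space over the field of rational functions over $\mathbb Q$ in the variables of $F$. -/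

import Mathlib

noncomputable section

/-! ### Walks confined to an orthant -/

/-- Position reached after the first `k` steps of a walk that starts from the origin. A walk of
length `n` is the sequence `w` of its (possibly labelled) steps, and the step labelled `a`
is the translation by `move a`. -/
def walkPosition {A G : Type*} [AddCommMonoid G] (move : A → G) {n : ℕ} (w : Fin n → A) (k : ℕ) :
    G :=
  ∑ i : Fin n with i.val < k, move (w i)

open Classical in
/-- The walks of length `n` with steps in `steps` that start from the origin and visit only points
with non-negative coordinates. Here `G` is `ℤ` (walks on `ℕ`) or `ℤ × ℤ` with the componentwise
order (walks in the quadrant `ℕ × ℕ`). -/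
def confinedWalks {A G : Type*} [AddCommMonoid G] [LE G] (steps : Finset A) (move : A → G)
    (n : ℕ) : Finset (Fin n → A) :=
  (Fintype.piFinset fun _ : Fin n => steps).filter fun w => ∀ k ≤ n, 0 ≤ walkPosition move w k

/-- `Q(x,y;t)`: the generating function of quadrant walks with steps in `S`. The variables are
numbered `0 = x`, `1 = y` (coordinates of the endpoint), `2 = t` (length). -/
def quadrantGF (S : Finset (ℤ × ℤ)) : MvPowerSeries (Fin 3) ℚ := fun d =>
  (((confinedWalks S id (d 2)).filter fun w =>
    walkPosition id w (d 2) = ((d 0 : ℤ), (d 1 : ℤ))).card : ℚ)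

/-- `C₁(x,v;t)`: the generating function of walks on `ℕ` with steps in the multiset `U ∪ V`.
The multiset is realized as the disjoint sum of `U` and `V`: a step is either `Sum.inl u`, `u ∈ U`,
or `Sum.inr v`, `v ∈ V`. The variables are numbered `0 = v` (number of steps in `V`),
`1 = x` (endpoint), `2 = t` (length). -/
def horizontalGF (U V : Finset ℤ) : MvPowerSeries (Fin 3) ℚ := fun d =>
  (((confinedWalks (U.disjSum V) (Sum.elim id id) (d 2)).filter fun w =>
    walkPosition (Sum.elim id id) w (d 2) = (d 1 : ℤ) ∧
      (Finset.univ.filter fun i => (w i).isRight).card = d 0).card : ℚ)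

/-- `C₂(y;v)`: the generating function of walks on `ℕ` with steps in `T`. The variables are
numbered `0 = v` (length), `1 = y` (endpoint). -/
def verticalGF (T : Finset ℤ) : MvPowerSeries (Fin 2) ℚ := fun d =>
  (((confinedWalks T id (d 0)).filter fun w => walkPosition id w (d 0) = (d 1 : ℤ)).card : ℚ)

/-! ### Step polynomials -/

/-- The Laurent polynomial `∑ i ∈ A, x ^ i` of a finite set `A` of integers. -/
def generatingPolynomial (K : Type*) [Field K] (A : Finset ℤ) : LaurentPolynomial K :=
  ∑ i ∈ A, LaurentPolynomial.T i

/-- Laurent polynomials in two variables `x, y`: the group algebra of `ℤ × ℤ`, in which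
`AddMonoidAlgebra.single (i, j) 1` is the monomial `x ^ i * y ^ j`. -/
abbrev LaurentPolynomial₂ (K : Type*) [Field K] : Type _ := AddMonoidAlgebra K (ℤ × ℤ)

/-- The step polynomial `S(x,y) = ∑ (i,j) ∈ S, x ^ i * y ^ j`. -/
def stepPolynomial (K : Type*) [Field K] (S : Finset (ℤ × ℤ)) : LaurentPolynomial₂ K :=
  ∑ s ∈ S, AddMonoidAlgebra.single s 1

/-- A Laurent polynomial `P`, as the Laurent polynomial `P(x)` in `x, y`. -/
def inX {K : Type*} [Field K] (P : LaurentPolynomial K) : LaurentPolynomial₂ K :=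
  AddMonoidAlgebra.mapDomainRingHom K (AddMonoidHom.inl ℤ ℤ) P

/-- A Laurent polynomial `P`, as the Laurent polynomial `P(y)` in `x, y`. -/
def inY {K : Type*} [Field K] (P : LaurentPolynomial K) : LaurentPolynomial₂ K :=
  AddMonoidAlgebra.mapDomainRingHom K (AddMonoidHom.inr ℤ ℤ) P

/-! ### Hadamard product and evaluation at `v = 1` -/

/-- The Hadamard product `(∑ aₙ vⁿ) ⊙ (∑ bₙ vⁿ) = ∑ aₙ bₙ vⁿ` of series in `v` over `R`. -/
def hadamardProduct {R : Type*} [CommRing R] (F G : PowerSeries R) : PowerSeries R :=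
  PowerSeries.mk fun n => PowerSeries.coeff n F * PowerSeries.coeff n G

/-- The evaluation at `v = 1` of the series `H = ∑ hₙ vⁿ`, with coefficients `hₙ` in a ring of
formal power series, is well defined and equal to `G`: for each monomial, only finitely many of the
`hₙ` contribute to its coefficient, and the sum of these contributions is its coefficient
in `G`. -/
def HasEvalAtOne {σ : Type*} (H : PowerSeries (MvPowerSeries σ ℚ)) (G : MvPowerSeries σ ℚ) : Prop :=
  ∀ d : σ →₀ ℕ,
    {n : ℕ | MvPowerSeries.coeff d (PowerSeries.coeff n H) ≠ 0}.Finite ∧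
      MvPowerSeries.coeff d G = ∑ᶠ n : ℕ, MvPowerSeries.coeff d (PowerSeries.coeff n H)

/-- A series in the variables `v, x, t` (numbered `0, 1, 2`), as a power series in `v` with
coefficients in `ℚ[[x,y,t]]` (variables numbered `0, 1, 2`). -/
def expandVXT (F : MvPowerSeries (Fin 3) ℚ) : PowerSeries (MvPowerSeries (Fin 3) ℚ) :=
  PowerSeries.map (MvPowerSeries.rename (R := ℚ) ![(0 : Fin 3), 2]).toRingHom
    (MvPowerSeries.finSuccEquiv ℚ 2 F)

/-- A series in the variables `v, y` (numbered `0, 1`), as a power series in `v` with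
coefficients in `ℚ[[x,y,t]]` (variables numbered `0, 1, 2`). -/
def expandVY (F : MvPowerSeries (Fin 2) ℚ) : PowerSeries (MvPowerSeries (Fin 3) ℚ) :=
  PowerSeries.map (MvPowerSeries.rename (R := ℚ) ![(1 : Fin 3)]).toRingHom
    (MvPowerSeries.finSuccEquiv ℚ 1 F)

/-! ### Algebraic and D-finite series -/

/-- A power series is algebraic if it is a root of a non-zero polynomial whose coefficients are
polynomials over `ℚ` in the variables of the series. -/
def IsAlgebraicSeries {σ : Type*} (F : MvPowerSeries σ ℚ) : Prop :=
  ∃ P : Polynomial (MvPolynomial σ ℚ), P ≠ 0 ∧ Polynomial.aeval F P = 0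

instance faithfulSMul_mvPolynomial_mvPowerSeries (σ : Type*) :
    FaithfulSMul (MvPolynomial σ ℚ) (MvPowerSeries σ ℚ) := by
  rw [faithfulSMul_iff_algebraMap_injective]
  intro p q h
  apply MvPolynomial.coe_injective
  simpa [MvPowerSeries.algebraMap_apply'] using h

/-- The field `ℚ(x₁, x₂, …)` of rational functions acts on the fraction field of the ring of
power series in the same variables. -/
instance algebra_rationalFunctions (σ : Type*) :
    Algebra (FractionRing (MvPolynomial σ ℚ)) (FractionRing (MvPowerSeries σ ℚ)) :=
  FractionRing.liftAlgebra (MvPolynomial σ ℚ) (FractionRing (MvPowerSeries σ ℚ))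

/-- A power series `F` is D-finite with respect to the variable `i` if the iterated derivatives
`∂ᵢᵐ F`, `m ≥ 0`, span a finite-dimensional vector space over the field of rational functions in
the variables of the series. -/
def IsDFiniteIn {σ : Type*} (i : σ) (F : MvPowerSeries σ ℚ) : Prop :=
  FiniteDimensional (FractionRing (MvPolynomial σ ℚ))
    (Submodule.span (FractionRing (MvPolynomial σ ℚ))
      (Set.range fun m : ℕ =>
        algebraMap (MvPowerSeries σ ℚ) (FractionRing (MvPowerSeries σ ℚ))
          ((MvPowerSeries.pderiv ℚ i)^[m] F)))

/-- A power series is D-finite if it is D-finite with respect to each of its variables. -/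
def IsDFinite {σ : Type*} (F : MvPowerSeries σ ℚ) : Prop :=
  ∀ i : σ, IsDFiniteIn i F

end

/-! Counting: in a Hadamard model a step either lies in `U` and leaves the ordinate fixed, or is a
pair in `V × T`. Deleting the `U`-steps from the second projection of a quadrant walk leaves a
`T`-walk on `ℕ` whose length is the number of `V`-steps, and both projections stay on `ℕ` exactly
when the walk stays in the quadrant. So the coefficient of `v ^ m` in `C₁` is paired with that in
`C₂`, which is the Hadamard product at `v = 1`. `IsHadamardModel.walkWeight_eq` proves this by
induction on the last step.

Algebraicity of one-dimensional walks (`isAlgebraic_walkSeries`) is the kernel method in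
factorization form. With `p = x ^ a * S(x)` a polynomial, the kernel `k = x ^ a - t p` satisfies `k
c = B`, where `c` is the walk series and `B` is monic of degree `a` in `x` over `R⟦t⟧`. The inverse
`d` of `c` turns out to be a polynomial in `x`, so `B` divides `k` in `R⟦t⟧[x]`. Coefficients of a
monic divisor are algebraic, hence so are `B` and `c = B / k`.

D-finiteness: `Q` is the coefficient of `w ^ 0` in `C₁(x, 1/w; t) C₂(y; w)`. Setting `t = τ w` turns
this product into an honest algebraic power series `F` in `τ, w, x, y` (`mergedSeries`). Lipshitz's
argument then eliminates `w`. The derivatives of an algebraic element live, up to denominators, in a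
finite module with linearly growing degrees, so a dimension count yields a nonzero relation `∑
p_{b,c} w^(N-c) δ₁^b (δ₂-1)⋯(δ₂-c) F = 0` with `p_{b,c}` free of `w`
(`exists_elimination_relation`), where `δ₂ = w ∂_w` at constant `t` and `δ₁` is the Euler derivation
of the chosen variable. If `c₀` is the least `c` that occurs, extracting `w^(N-c₀)` kills all terms
with `c > c₀`, because the product annihilates `w, …, w^c`. What remains is a differential equation
for the coefficient of `w ^ 0`, that is, for `Q`. -/

noncomputable section

/-! ### Confined walks, their weights and the last-step recursion. -/

section Walks

variable {A G R : Type*}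

lemma walkPosition_snoc_of_le [AddCommMonoid G] (move : A → G) {n : ℕ} (w : Fin n → A) (a : A)
    {k : ℕ} (hk : k ≤ n) :
    walkPosition move (Fin.snoc w a : Fin (n + 1) → A) k = walkPosition move w k := by
  simp only [walkPosition, Finset.sum_filter, Fin.sum_univ_castSucc, Fin.snoc_castSucc,
    Fin.val_castSucc, Fin.snoc_last, Fin.val_last]
  rw [if_neg (by omega), add_zero]

lemma walkPosition_snoc_last [AddCommMonoid G] (move : A → G) {n : ℕ} (w : Fin n → A) (a : A) :
    walkPosition move (Fin.snoc w a : Fin (n + 1) → A) (n + 1) =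
      walkPosition move w n + move a := by
  simp only [walkPosition, Finset.sum_filter, Fin.sum_univ_castSucc, Fin.snoc_castSucc,
    Fin.val_castSucc, Fin.snoc_last, Fin.val_last]
  rw [if_pos (by omega)]
  congr 1
  refine Finset.sum_congr rfl fun i _ => ?_
  rw [if_pos (by omega), if_pos i.2]

lemma mem_confinedWalks [AddCommMonoid G] [LE G] {steps : Finset A} {move : A → G} {n : ℕ}
    {w : Fin n → A} :
    w ∈ confinedWalks steps move n ↔
      (∀ i, w i ∈ steps) ∧ ∀ k ≤ n, 0 ≤ walkPosition move w k := by
  simp [confinedWalks, Fintype.mem_piFinset]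

lemma snoc_mem_confinedWalks [AddCommMonoid G] [LE G] {steps : Finset A} {move : A → G} {n : ℕ}
    {w : Fin n → A} {a : A} :
    (Fin.snoc w a : Fin (n + 1) → A) ∈ confinedWalks steps move (n + 1) ↔
      a ∈ steps ∧ w ∈ confinedWalks steps move n ∧ 0 ≤ walkPosition move w n + move a := by
  simp only [mem_confinedWalks]
  constructor
  · rintro ⟨h, h'⟩
    refine ⟨by simpa using h (Fin.last n), ⟨fun i => by simpa using h i.castSucc, fun k hk => ?_⟩, ?_⟩
    · simpa [walkPosition_snoc_of_le move w a hk] using h' k (by omega)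
    · simpa [walkPosition_snoc_last] using h' (n + 1) le_rfl
  · rintro ⟨ha, ⟨h, h'⟩, hl⟩
    refine ⟨fun i => ?_, fun k hk => ?_⟩
    · refine Fin.lastCases ?_ (fun j => ?_) i
      · simpa using ha
      · simpa using h j
    · rcases Nat.lt_or_ge n k with hnk | hnk
      · obtain rfl : k = n + 1 := by omega
        rwa [walkPosition_snoc_last]
      · rw [walkPosition_snoc_of_le move w a hnk]
        exact h' k hnk

open Classical in
/-- The total weight of the confined walks of length `n` that end at `g`, where the weight of a
walk is the product of the weights of its steps. -/
def walkWeight [AddCommMonoid G] [LE G] [CommSemiring R] (steps : Finset A) (move : A → G)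
    (ω : A → R) (n : ℕ) (g : G) : R :=
  ∑ w ∈ confinedWalks steps move n with walkPosition move w n = g, ∏ i, ω (w i)

open Classical in
lemma walkWeight_zero [AddCommMonoid G] [Preorder G] [CommSemiring R] (steps : Finset A)
    (move : A → G) (ω : A → R) (g : G) :
    walkWeight steps move ω 0 g = if g = 0 then 1 else 0 := by
  have h : confinedWalks steps move 0 = Finset.univ := by
    ext w
    simp only [Finset.mem_univ, iff_true, mem_confinedWalks]
    simp [walkPosition]
  simp only [walkWeight, h, walkPosition, Finset.sum_filter]
  simp [eq_comm]

lemma walkWeight_of_not_nonneg [AddCommMonoid G] [LE G] [CommSemiring R] (steps : Finset A)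
    (move : A → G) (ω : A → R) (n : ℕ) {g : G} (hg : ¬ 0 ≤ g) :
    walkWeight steps move ω n g = 0 := by
  classical
  refine Finset.sum_eq_zero fun w hw => ?_
  simp only [Finset.mem_filter, mem_confinedWalks] at hw
  exact absurd (hw.2 ▸ hw.1.2 n le_rfl) hg

-- Removing the last step of a walk gives a bijection. Both the kernel equation and the comparison
-- of quadrant walks with pairs of walks rest on this recursion.
open Classical in
lemma walkWeight_succ [AddCommGroup G] [Preorder G] [CommSemiring R] (steps : Finset A)
    (move : A → G) (ω : A → R) (n : ℕ) (g : G) :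
    walkWeight steps move ω (n + 1) g =
      if 0 ≤ g then ∑ a ∈ steps, ω a * walkWeight steps move ω n (g - move a) else 0 := by
  split_ifs with hg
  · simp only [walkWeight, Finset.mul_sum]
    rw [Finset.sum_sigma']
    refine Finset.sum_bij' (fun w _ => ⟨w (Fin.last n), Fin.init w⟩)
      (fun p _ => Fin.snoc p.2 p.1) ?_ ?_ ?_ ?_ ?_
    · intro w hw
      rw [← Fin.snoc_init_self w] at hw
      simp only [Finset.mem_filter, snoc_mem_confinedWalks, walkPosition_snoc_last] at hw
      simp only [Finset.mem_sigma, Finset.mem_filter]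
      exact ⟨hw.1.1, hw.1.2.1, eq_sub_of_add_eq hw.2⟩
    · rintro ⟨a, w⟩ hp
      simp only [Finset.mem_sigma, Finset.mem_filter] at hp
      simp only [Finset.mem_filter, snoc_mem_confinedWalks, walkPosition_snoc_last, hp.2.2,
        sub_add_cancel]
      exact ⟨⟨hp.1, hp.2.1, hg⟩, trivial⟩
    · intro w _
      exact Fin.snoc_init_self w
    · rintro ⟨a, w⟩ _
      simp
    · intro w _
      rw [Fin.prod_univ_castSucc, mul_comm]
      rfl
  · exact walkWeight_of_not_nonneg _ _ _ _ hg

/-- The weighted generating polynomial of the endpoints of the walks of length `n` on `ℕ`. -/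
def walkPolynomial [CommSemiring R] (steps : Finset A) (move : A → ℤ) (ω : A → R) (n : ℕ) :
    Polynomial R :=
  ∑ w ∈ confinedWalks steps move n,
    Polynomial.C (∏ i, ω (w i)) * Polynomial.X ^ (walkPosition move w n).toNat

lemma coeff_walkPolynomial [CommSemiring R] (steps : Finset A) (move : A → ℤ) (ω : A → R)
    (n i : ℕ) : (walkPolynomial steps move ω n).coeff i = walkWeight steps move ω n i := by
  classical
  simp only [walkPolynomial, walkWeight, Polynomial.finsetSum_coeff, Polynomial.coeff_C_mul_X_pow,
    Finset.sum_filter]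
  refine Finset.sum_congr rfl fun w hw => ?_
  have := (mem_confinedWalks.1 hw).2 n le_rfl
  congr 1
  simp only [eq_iff_iff]
  omega

/-- The generating function of weighted walks on `ℕ` with respect to length and endpoint. -/
def walkSeries [CommSemiring R] (steps : Finset A) (move : A → ℤ) (ω : A → R) :
    PowerSeries (Polynomial R) :=
  PowerSeries.mk (walkPolynomial steps move ω)

end Walks

/-! ### Polynomials over `R⟦t⟧` inside `R[x]⟦t⟧`, and monic divisors. -/

section Swap

variable {R : Type*} [CommRing R]

/-- A polynomial in `x` over `R⟦t⟧`, as a power series in `t` over `R[x]`. -/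
def polynomialToSeries (R : Type*) [CommRing R] :
    Polynomial (PowerSeries R) →+* PowerSeries (Polynomial R) :=
  Polynomial.eval₂RingHom (PowerSeries.map Polynomial.C) (PowerSeries.C Polynomial.X)

lemma coeff_polynomialToSeries (f : Polynomial (PowerSeries R)) (n i : ℕ) :
    (PowerSeries.coeff n (polynomialToSeries R f)).coeff i = PowerSeries.coeff n (f.coeff i) := by
  induction f using Polynomial.induction_on' with
  | add p q hp hq => simp [hp, hq]
  | monomial k r =>
    simp only [polynomialToSeries, Polynomial.coe_eval₂RingHom, Polynomial.eval₂_monomial,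
      ← map_pow, PowerSeries.coeff_mul_C, PowerSeries.coeff_map, Polynomial.coeff_C_mul,
      Polynomial.coeff_X_pow, Polynomial.coeff_monomial]
    split_ifs with h1 h2 <;> simp_all

lemma polynomialToSeries_injective : Function.Injective (polynomialToSeries R) := by
  intro f g h
  ext i n
  rw [← coeff_polynomialToSeries, h, coeff_polynomialToSeries]

/-- The truncation to degree `< d` in `x` of a series in `t` over `R[x]`, as a polynomial in `x`. -/
def truncInX (d : ℕ) (f : PowerSeries (Polynomial R)) : Polynomial (PowerSeries R) :=
  ∑ j ∈ Finset.range d, Polynomial.monomial j (PowerSeries.mk fun n => (PowerSeries.coeff n f).coeff j)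

lemma degree_truncInX_lt (d : ℕ) (f : PowerSeries (Polynomial R)) : (truncInX d f).degree < d := by
  rw [Polynomial.degree_lt_iff_coeff_zero]
  intro m hm
  simp only [truncInX, Polynomial.finsetSum_coeff, Polynomial.coeff_monomial]
  refine Finset.sum_eq_zero fun j hj => if_neg ?_
  rw [Finset.mem_range] at hj
  omega

/-- A bound on the `x`-degree that is uniform in the power of `t` is what places a series over
`R[x]` in `R⟦t⟧[x]`. -/
lemma polynomialToSeries_truncInX {d : ℕ} {f : PowerSeries (Polynomial R)}
    (hf : ∀ n i, d ≤ i → (PowerSeries.coeff n f).coeff i = 0) :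
    polynomialToSeries R (truncInX d f) = f := by
  ext n i
  rw [coeff_polynomialToSeries]
  simp only [truncInX, Polynomial.finsetSum_coeff, Polynomial.coeff_monomial, Finset.sum_ite_eq',
    Finset.mem_range]
  split_ifs with h
  · simp
  · simp [hf n i (by omega)]

/-- A power series in `t` over `R[x]` that is a polynomial in `x` with coefficients algebraic over
`R[t]` is algebraic over `R[x][t]`. -/
lemma isAlgebraic_polynomialToSeries [IsDomain R] {f : Polynomial (PowerSeries R)}
    (hf : ∀ i, IsAlgebraic (Polynomial R) (f.coeff i)) :
    IsAlgebraic (Polynomial (Polynomial R)) (polynomialToSeries R f) := by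
  have key : ∀ g : PowerSeries R, IsAlgebraic (Polynomial R) g →
      IsAlgebraic (Polynomial (Polynomial R))
        (PowerSeries.map (Polynomial.C : R →+* Polynomial R) g) := by
    intro g hg
    refine hg.ringHom_of_comp_eq (Polynomial.mapRingHom (Polynomial.C : R →+* Polynomial R)) _
      (Polynomial.map_injective _ Polynomial.C_injective) ?_
    ext <;> simp [PowerSeries.algebraMap_apply']
  have h : polynomialToSeries R f = ∑ i ∈ f.support,
      PowerSeries.map Polynomial.C (f.coeff i) * (PowerSeries.C Polynomial.X) ^ i := by
    simp [polynomialToSeries, Polynomial.eval₂_eq_sum, Polynomial.sum]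
  rw [h]
  refine Subalgebra.sum_mem (Subalgebra.algebraicClosure (Polynomial (Polynomial R)) _)
    fun i _ => ?_
  refine (key _ (hf i)).mul (IsAlgebraic.pow ?_ i)
  have : (PowerSeries.C Polynomial.X : PowerSeries (Polynomial R)) =
      algebraMap (Polynomial (Polynomial R)) _ (Polynomial.C Polynomial.X) := by
    simp [PowerSeries.algebraMap_apply']
  rw [this]
  exact isAlgebraic_algebraMap _

/-- The coefficients of a monic divisor of a non-zero polynomial are algebraic over the ring
generated by the coefficients of the polynomial. -/
lemma isAlgebraic_coeff_of_monic_dvd {R S : Type*} [CommRing R] [IsDomain R] [CommRing S]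
    [IsDomain S] [Algebra R S] [FaithfulSMul R S] {p : Polynomial R} {q : Polynomial S}
    (hp : p ≠ 0) (hq : q.Monic) (h : q ∣ p.map (algebraMap R S)) (i : ℕ) :
    IsAlgebraic R (q.coeff i) := by
  let := FractionRing.liftAlgebra R (FractionRing S)
  have hp' : p.map (algebraMap R (FractionRing R)) ≠ 0 :=
    (Polynomial.map_ne_zero_iff (IsFractionRing.injective R _)).2 hp
  -- Over the fraction field `p` can be made monic, and a monic divisor of a monic polynomial has
  -- integral coefficients.
  have hdvd : q.map (algebraMap S (FractionRing S)) ∣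
      (p.map (algebraMap R (FractionRing R)) *
        Polynomial.C (p.map (algebraMap R (FractionRing R))).leadingCoeff⁻¹).map
          (algebraMap (FractionRing R) (FractionRing S)) := by
    rw [Polynomial.map_mul, Polynomial.map_map, ← IsScalarTower.algebraMap_eq,
      IsScalarTower.algebraMap_eq R S (FractionRing S), ← Polynomial.map_map]
    exact (Polynomial.map_dvd _ h).mul_right _
  have := Polynomial.isIntegral_coeff_of_dvd _ _
    (Polynomial.monic_mul_leadingCoeff_inv hp') (hq.map _) hdvd i
  rw [Polynomial.coeff_map] at this
  have h2 : IsAlgebraic R (algebraMap S (FractionRing S) (q.coeff i)) :=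
    (IsFractionRing.isAlgebraic_iff R (FractionRing R) (FractionRing S)).2 this.isAlgebraic
  exact (isAlgebraic_algebraMap_iff (IsFractionRing.injective S (FractionRing S))).1 h2

end Swap

/-! ### The kernel method: walk series on `ℕ` are algebraic. -/

section WalkSeries

variable {A R : Type*} [CommRing R] (steps : Finset A) (move : A → ℤ) (ω : A → R)

/-- The step polynomial of weighted one-dimensional steps, multiplied by `x ^ a`. -/
def shiftedStepPolynomial (a : ℕ) : Polynomial R :=
  ∑ s ∈ steps, Polynomial.C (ω s) * Polynomial.X ^ (a + move s).toNat

variable {steps move}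

lemma coeff_shiftedStepPolynomial_of_lt {a b : ℕ} (hb : ∀ s ∈ steps, move s ≤ b) {i : ℕ}
    (hi : a + b < i) : (shiftedStepPolynomial steps move ω a).coeff i = 0 := by
  simp only [shiftedStepPolynomial, Polynomial.finsetSum_coeff, Polynomial.coeff_C_mul_X_pow]
  refine Finset.sum_eq_zero fun s hs => if_neg ?_
  have := hb s hs
  omega

/-- After the shift by `a`, degrees at least `a` correspond to endpoints in `ℕ`. Degrees below `a`
are the forbidden steps. -/
lemma coeff_shiftedStepPolynomial_mul {a : ℕ} (ha : ∀ s ∈ steps, -(a : ℤ) ≤ move s) (n i : ℕ) :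
    (shiftedStepPolynomial steps move ω a * walkPolynomial steps move ω n).coeff (i + a) =
      (walkPolynomial steps move ω (n + 1)).coeff i := by
  rw [coeff_walkPolynomial, walkWeight_succ, if_pos (by positivity), shiftedStepPolynomial,
    Finset.sum_mul, Polynomial.finsetSum_coeff]
  refine Finset.sum_congr rfl fun s hs => ?_
  rw [mul_assoc, Polynomial.coeff_C_mul, Polynomial.coeff_X_pow_mul']
  have := ha s hs
  split_ifs with h
  · rw [coeff_walkPolynomial]
    congr 2
    omega
  · rw [walkWeight_of_not_nonneg]
    omega

/-- The generating function of weighted walks on `ℕ` is algebraic. -/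
theorem isAlgebraic_walkSeries [IsDomain R] :
    IsAlgebraic (Polynomial (Polynomial R)) (walkSeries steps move ω) := by
  obtain ⟨a, ha⟩ : ∃ a : ℕ, ∀ s ∈ steps, -(a : ℤ) ≤ move s := by
    refine ⟨∑ s ∈ steps, (move s).natAbs, fun s hs => ?_⟩
    have := Finset.single_le_sum (f := fun s => (move s).natAbs) (fun _ _ => Nat.zero_le _) hs
    omega
  obtain ⟨b, hb⟩ : ∃ b : ℕ, ∀ s ∈ steps, move s ≤ b := by
    refine ⟨∑ s ∈ steps, (move s).natAbs, fun s hs => ?_⟩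
    have := Finset.single_le_sum (f := fun s => (move s).natAbs) (fun _ _ => Nat.zero_le _) hs
    omega
  set c := walkSeries steps move ω with hc
  set p := shiftedStepPolynomial steps move ω a with hp
  set r : PowerSeries (Polynomial R) := PowerSeries.mk fun n =>
    p * walkPolynomial steps move ω n - walkPolynomial steps move ω (n + 1) * Polynomial.X ^ a
    with hr
  have hr0 : ∀ n i, a ≤ i → (PowerSeries.coeff n r).coeff i = 0 := by
    intro n i hi
    obtain ⟨j, rfl⟩ := Nat.exists_eq_add_of_le' hi
    rw [hr, PowerSeries.coeff_mk, Polynomial.coeff_sub, coeff_shiftedStepPolynomial_mul ω ha,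
      Polynomial.coeff_mul_X_pow, sub_self]
  set xa : PowerSeries (Polynomial R) := PowerSeries.C (Polynomial.X ^ a) with hxa
  set k : PowerSeries (Polynomial R) := xa - PowerSeries.C p * PowerSeries.X with hk
  -- Kernel equation: `r` collects the steps that would leave `ℕ`, so its degree in `x` is below
  -- `a`.
  have hkc : k * c = xa - r * PowerSeries.X := by
    ext1 n
    cases n with
    | zero =>
      have : walkPolynomial steps move ω 0 = 1 := by
        ext i
        rw [coeff_walkPolynomial, walkWeight_zero, Polynomial.coeff_one]
        simp
      simp [hk, hxa, hc, walkSeries, sub_mul, mul_assoc, this, mul_comm PowerSeries.X]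
    | succ n =>
      have h1 : PowerSeries.coeff (n + 1) xa = 0 := by
        rw [hxa, PowerSeries.coeff_C]; simp
      rw [hk, sub_mul, map_sub, map_sub, h1, PowerSeries.coeff_succ_mul_X, mul_assoc,
        mul_comm PowerSeries.X, ← mul_assoc, PowerSeries.coeff_succ_mul_X, hxa,
        PowerSeries.coeff_C_mul, PowerSeries.coeff_C_mul, hr, hc, walkSeries]
      simp only [PowerSeries.coeff_mk]
      ring
  set d : PowerSeries (Polynomial R) := PowerSeries.invOfUnit c 1 with hd
  have hcd : c * d = 1 := by
    refine PowerSeries.mul_invOfUnit c 1 ?_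
    rw [← PowerSeries.coeff_zero_eq_constantCoeff_apply, hc, walkSeries, PowerSeries.coeff_mk]
    ext i
    rw [coeff_walkPolynomial, walkWeight_zero, Units.val_one, Polynomial.coeff_one]
    simp
  have hdk : d * (xa - r * PowerSeries.X) = k := by
    rw [← hkc, mul_comm, mul_assoc, hcd, mul_one]
  -- The inverse `d` has degree at most `b` in `x`. In `d x^a = k + d r t`, the kernel has degree at
  -- most `a + b`, and `r t` multiplies only earlier coefficients of `d` by polynomials of degree
  -- below `a`.
  have hd0 : ∀ n i, b + 1 ≤ i → (PowerSeries.coeff n d).coeff i = 0 := by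
    intro n
    induction n using Nat.strong_induction_on with
    | _ n ih =>
      intro i hi
      have h1 : d * xa = k + d * r * PowerSeries.X := by rw [← hdk]; ring
      have h2 := congrArg (fun f => (PowerSeries.coeff n f).coeff (i + a)) h1
      simp only [hxa, PowerSeries.coeff_mul_C, Polynomial.coeff_mul_X_pow, map_add,
        Polynomial.coeff_add] at h2
      rw [h2]
      have h3 : (PowerSeries.coeff n k).coeff (i + a) = 0 := by
        rw [hk, map_sub, hxa, PowerSeries.coeff_C, Polynomial.coeff_sub, PowerSeries.coeff_C_mul,
          PowerSeries.coeff_X]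
        have h4 : p.coeff (i + a) = 0 := coeff_shiftedStepPolynomial_of_lt ω hb (by omega)
        have h5 : (Polynomial.X ^ a : Polynomial R).coeff (i + a) = 0 := by
          rw [Polynomial.coeff_X_pow, if_neg (by omega)]
        split_ifs <;> simp [h4, h5]
      rw [h3, zero_add]
      cases n with
      | zero => simp
      | succ n =>
        rw [PowerSeries.coeff_succ_mul_X, PowerSeries.coeff_mul, Polynomial.finsetSum_coeff]
        refine Finset.sum_eq_zero fun x hx => ?_
        rw [Polynomial.coeff_mul]
        refine Finset.sum_eq_zero fun y hy => ?_
        rw [Finset.HasAntidiagonal.mem_antidiagonal] at hx hy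
        rcases Nat.lt_or_ge y.2 a with h | h
        · rw [ih x.1 (by omega) y.1 (by omega), zero_mul]
        · rw [hr0 _ _ h, mul_zero]
  set B : Polynomial (PowerSeries R) :=
    Polynomial.X ^ a - truncInX a (r * PowerSeries.X) with hB
  have hBm : B.Monic := Polynomial.monic_X_pow_sub (degree_truncInX_lt _ _)
  have hBs : polynomialToSeries R B = xa - r * PowerSeries.X := by
    rw [hB, map_sub, polynomialToSeries_truncInX]
    · simp [polynomialToSeries, hxa]
    · intro n i hi
      cases n with
      | zero => simp
      | succ n => rw [PowerSeries.coeff_succ_mul_X, hr0 _ _ hi]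
  set k₀ : Polynomial (Polynomial R) :=
    Polynomial.X ^ a - Polynomial.C Polynomial.X * p.map Polynomial.C with hk₀
  have hk₀s : polynomialToSeries R (k₀.map (algebraMap (Polynomial R) (PowerSeries R))) = k := by
    have : ∀ q : Polynomial R, polynomialToSeries R
        (q.map ((algebraMap (Polynomial R) (PowerSeries R)).comp Polynomial.C)) =
          PowerSeries.C q := by
      intro q
      ext n i
      rw [coeff_polynomialToSeries, Polynomial.coeff_map]
      simp only [RingHom.comp_apply, PowerSeries.algebraMap_apply', Algebra.algebraMap_self,
        PowerSeries.map_id, Polynomial.coe_C, PowerSeries.coeff_C, id_eq]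
      split_ifs <;> simp
    rw [hk₀, Polynomial.map_sub, Polynomial.map_mul, Polynomial.map_map, map_sub, map_mul, this,
      hk, mul_comm]
    simp [polynomialToSeries, hxa, PowerSeries.algebraMap_apply']
  -- At `t = 0` the kernel is `x ^ a`.
  have hk₀0 : k₀ ≠ 0 := by
    intro h
    have h1 := congrArg (fun q : Polynomial (Polynomial R) =>
      (q.map (Polynomial.evalRingHom (0 : R)))) h
    simp [hk₀] at h1
  -- The identity `d B = k`, read in `R⟦t⟧[x]`.
  have hdvd : B ∣ k₀.map (algebraMap (Polynomial R) (PowerSeries R)) := by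
    refine ⟨truncInX (b + 1) d, polynomialToSeries_injective ?_⟩
    rw [hk₀s, map_mul, hBs, polynomialToSeries_truncInX hd0, mul_comm, hdk]
  have : FaithfulSMul (Polynomial R) (PowerSeries R) := by
    rw [faithfulSMul_iff_algebraMap_injective]
    intro f g h
    simpa [PowerSeries.algebraMap_apply'] using h
  have hBalg := isAlgebraic_polynomialToSeries
    fun i => isAlgebraic_coeff_of_monic_dvd hk₀0 hBm hdvd i
  rw [hBs, ← hkc] at hBalg
  have hkalg : IsAlgebraic (Polynomial (Polynomial R)) k := by
    have : k = algebraMap (Polynomial (Polynomial R)) _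
        (Polynomial.C (Polynomial.X ^ a) - Polynomial.C p * Polynomial.X) := by
      simp [hk, hxa, PowerSeries.algebraMap_apply']
    rw [this]
    exact isAlgebraic_algebraMap _
  refine IsAlgebraic.of_mul (mem_nonZeroDivisors_of_ne_zero ?_) hkalg hBalg
  intro h0
  have h1 := congrArg PowerSeries.constantCoeff h0
  simp [hk, hxa] at h1

end WalkSeries

/-! ### Derivatives of an algebraic element with a common denominator. -/

section Denominator

variable {𝕜 𝕜' R M : Type*} [CommRing 𝕜] [CommRing 𝕜'] [CommRing R] [CommRing M] [Algebra R M]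
  [Algebra 𝕜 M] [Algebra 𝕜' R]

/-- Chain rule: `y` is `P` with `d` applied to its coefficients, evaluated at `G`. Only its
membership in `R[G]` matters. -/
lemma exists_derivation_aeval_eq (δ : Derivation 𝕜 M M) (d : Derivation 𝕜' R R)
    (hδ : ∀ r, δ (algebraMap R M r) = algebraMap R M (d r)) (G : M) (P : Polynomial R) :
    ∃ y ∈ Algebra.adjoin R {G}, δ (Polynomial.aeval G P) =
      y + Polynomial.aeval G (Polynomial.derivative P) * δ G := by
  induction P using Polynomial.induction_on' with
  | add p q hp hq =>
    obtain ⟨y, hy, h⟩ := hp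
    obtain ⟨z, hz, h'⟩ := hq
    refine ⟨y + z, add_mem hy hz, ?_⟩
    simp only [map_add, h, h']
    ring
  | monomial n r =>
    refine ⟨algebraMap R M (d r) * G ^ n, mul_mem (Subalgebra.algebraMap_mem _ _)
      (pow_mem (Algebra.self_mem_adjoin_singleton R G) n), ?_⟩
    simp only [Polynomial.aeval_monomial, Derivation.leibniz, hδ, Derivation.leibniz_pow,
      smul_eq_mul, Polynomial.derivative_monomial, map_mul, map_natCast, nsmul_eq_mul]
    ring

/-- An algebraic element lies, up to a denominator, in a finite subalgebra that is stable, up to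
the same denominator, under given derivations. -/
lemma exists_finite_subalgebra_of_isAlgebraic [IsDomain R] [IsDomain M] [CharZero R]
    [FaithfulSMul R M] {κ : Type*} (δ : κ → Derivation 𝕜 M M) (d : κ → Derivation 𝕜' R R)
    (hδ : ∀ k r, δ k (algebraMap R M r) = algebraMap R M (d k r)) {F : M}
    (hF : IsAlgebraic R F) :
    ∃ D : R, D ≠ 0 ∧ ∃ W : Subalgebra R M, (Subalgebra.toSubmodule W).FG ∧ D • F ∈ W ∧
      ∀ k, ∀ x ∈ W, D • δ k x ∈ W := by
  obtain ⟨l, hl, hG⟩ := hF.exists_integral_multiple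
  set G := l • F with hGdef
  set W := Algebra.adjoin R {G} with hW
  have hGW : G ∈ W := Algebra.self_mem_adjoin_singleton R G
  have hadj : ∀ P : Polynomial R, Polynomial.aeval G P ∈ W := fun P =>
    Polynomial.aeval_mem_adjoin_singleton R G
  -- Least degree among nonzero annihilating polynomials, not necessarily monic: by characteristic
  -- zero, `P'` is nonzero of smaller degree, so `P'(G) ≠ 0`.
  obtain ⟨P, ⟨hP0, hPG⟩, hmin⟩ := exists_minimalFor_of_wellFoundedLT
    (fun P : Polynomial R => P ≠ 0 ∧ Polynomial.aeval G P = 0) Polynomial.natDegree hG.isAlgebraic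
  have hdeg : 0 < P.natDegree := by
    by_contra h
    rw [Polynomial.eq_C_of_natDegree_eq_zero (by omega : P.natDegree = 0)] at hPG hP0
    rw [Polynomial.aeval_C, FaithfulSMul.algebraMap_eq_zero_iff] at hPG
    exact hP0 (by rw [hPG, map_zero])
  have hs : Polynomial.aeval G (Polynomial.derivative P) ≠ 0 := by
    intro h
    have h0 : Polynomial.derivative P ≠ 0 := by
      intro h0
      have := Polynomial.derivative_eq_zero.1 h0
      omega
    have := hmin (j := Polynomial.derivative P) ⟨h0, h⟩
      (Polynomial.natDegree_derivative_lt (by omega)).le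
    have := Polynomial.natDegree_derivative_lt (p := P) (by omega)
    omega
  have halg : IsAlgebraic R (Polynomial.aeval G (Polynomial.derivative P)) :=
    (Algebra.isAlgebraic_adjoin_singleton_iff.mpr hG.isAlgebraic) _ (hadj _)
  -- Rationalizes the denominator in `δ G = -y / P'(G)`: a multiple `t P'(G) = r` lies in `R`,
  -- whence `r δ G = -t y`.
  obtain ⟨t, ht, r, hr, hst⟩ :=
    halg.exists_nonzero_eq_adjoin_mul (mem_nonZeroDivisors_of_ne_zero hs)
  have htW : t ∈ W :=
    Algebra.adjoin_le (S := W) (Set.singleton_subset_iff.2 (hadj _)) ht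
  refine ⟨l * r, mul_ne_zero hl hr, W, hG.fg_adjoin_singleton, ?_, fun k x hx => ?_⟩
  · rw [mul_comm, mul_smul]
    exact Subalgebra.smul_mem _ hGW _
  · rw [mul_smul]
    refine Subalgebra.smul_mem _ ?_ _
    induction hx using Algebra.adjoin_induction with
    | mem x hx =>
      rw [Set.mem_singleton_iff] at hx
      rw [hx]
      obtain ⟨y, hy, h⟩ := exists_derivation_aeval_eq (δ k) (d k) (hδ k) G P
      rw [hPG, map_zero] at h
      have : r • δ k G = -(t * y) := by
        rw [Algebra.smul_def, ← hst]
        linear_combination -t * h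
      rw [this]
      exact neg_mem (mul_mem htW hy)
    | algebraMap a =>
      rw [hδ]
      exact Subalgebra.smul_mem _ (Subalgebra.algebraMap_mem _ _) _
    | add x y _ _ hx hy =>
      rw [map_add, smul_add]
      exact add_mem hx hy
    | mul x y hx' hy' hx hy =>
      rw [Derivation.leibniz, smul_add, smul_eq_mul, smul_eq_mul, ← mul_smul_comm,
        ← mul_smul_comm]
      exact add_mem (mul_mem hx' hy) (mul_mem hy' hx)

end Denominator

/-! ### Lipshitz's elimination of the polynomial variable by a dimension count. -/

section Filtration

open Polynomial

variable {𝕜 𝕜' R M : Type*} [CommRing 𝕜] [CommRing 𝕜'] [CommRing R] [CommRing M]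
  [Algebra (Polynomial R) M] [Algebra 𝕜 M] [Algebra 𝕜' (Polynomial R)]

/-- The element `g` is a combination of the `e i` whose coefficients have degree at most `j`. -/
def IsCombinationOfDegreeLE {m : ℕ} (e : Fin m → M) (j : ℕ) (g : M) : Prop :=
  ∃ r : Fin m → R[X], (∀ i, (r i).natDegree ≤ j) ∧ g = ∑ i, r i • e i

namespace IsCombinationOfDegreeLE

variable {m : ℕ} {e : Fin m → M} {j k : ℕ} {g h : M}

lemma mono (hg : IsCombinationOfDegreeLE (R := R) e j g) (hjk : j ≤ k) :
    IsCombinationOfDegreeLE (R := R) e k g := by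
  obtain ⟨r, hr, rfl⟩ := hg
  exact ⟨r, fun i => (hr i).trans hjk, rfl⟩

lemma add (hg : IsCombinationOfDegreeLE (R := R) e j g)
    (hh : IsCombinationOfDegreeLE (R := R) e j h) :
    IsCombinationOfDegreeLE (R := R) e j (g + h) := by
  obtain ⟨r, hr, rfl⟩ := hg
  obtain ⟨s, hs, rfl⟩ := hh
  refine ⟨fun i => r i + s i, fun i => natDegree_add_le_of_degree_le (hr i) (hs i), ?_⟩
  simp [add_smul, Finset.sum_add_distrib]

lemma smul {q : R[X]} (hg : IsCombinationOfDegreeLE (R := R) e j g) (hq : q.natDegree ≤ k) :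
    IsCombinationOfDegreeLE (R := R) e (k + j) (q • g) := by
  obtain ⟨r, hr, rfl⟩ := hg
  refine ⟨fun i => q * r i, fun i => natDegree_mul_le_of_le hq (hr i), ?_⟩
  simp [Finset.smul_sum, mul_smul]

lemma zero : IsCombinationOfDegreeLE (R := R) e j 0 := ⟨0, by simp, by simp⟩

lemma sum {ι : Type*} (s : Finset ι) {g : ι → M}
    (hg : ∀ i ∈ s, IsCombinationOfDegreeLE (R := R) e j (g i)) :
    IsCombinationOfDegreeLE (R := R) e j (∑ i ∈ s, g i) :=
  Finset.sum_induction _ _ (fun _ _ => add) zero hg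

lemma exists_of_mem_span (hg : g ∈ Submodule.span R[X] (Set.range e)) :
    ∃ j, IsCombinationOfDegreeLE (R := R) e j g := by
  obtain ⟨r, rfl⟩ := (Submodule.mem_span_range_iff_exists_fun R[X]).1 hg
  exact ⟨∑ i, (r i).natDegree, r, fun i =>
    Finset.single_le_sum (f := fun i => (r i).natDegree) (fun _ _ => Nat.zero_le _)
      (Finset.mem_univ i), rfl⟩

/-- A derivation that is stable on the span of the `e i` up to a denominator `D` raises degrees by
a bounded amount. -/
lemma derivation {c n : ℕ} {D : R[X]} (hD : D.natDegree ≤ c) {δ : Derivation 𝕜 M M}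
    {d : Derivation 𝕜' R[X] R[X]} (hδ : ∀ r, δ (algebraMap R[X] M r) = algebraMap R[X] M (d r))
    (hd : ∀ r, (d r).natDegree ≤ r.natDegree)
    (he : ∀ i, IsCombinationOfDegreeLE (R := R) e c (D • δ (e i)))
    (hg : IsCombinationOfDegreeLE (R := R) e (c * n + k) (D ^ n • g)) :
    IsCombinationOfDegreeLE (R := R) e (c * (n + 1) + k) (D ^ (n + 1) • δ g) := by
  have hsmul : ∀ (r : R[X]) (x : M), δ (r • x) = d r • x + r • δ x := by
    intro r x
    rw [Algebra.smul_def, Derivation.leibniz, hδ, smul_eq_mul, smul_eq_mul, Algebra.smul_def,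
      Algebra.smul_def]
    ring
  have hdeg : c * (n + 1) + k = c + (c * n + k) := by ring
  have hpow : D * d (D ^ n) = (-(n : R[X]) * d D) * (-1) * D ^ n := by
    rw [Derivation.leibniz_pow]
    cases n with
    | zero => simp
    | succ n => simp only [smul_eq_mul, nsmul_eq_mul, Nat.add_sub_cancel]; ring
  -- Leibniz's rule for `D ^ n • g`, multiplied by `D`: one derivative costs one factor `D` and at
  -- most `c` in degree.
  have h1 : D ^ (n + 1) • δ g = D • δ (D ^ n • g) + (-(n : R[X]) * d D) • (D ^ n • g) := by
    rw [hsmul, smul_add, ← mul_smul, ← mul_smul, ← mul_smul, hpow, pow_succ']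
    module
  rw [h1, hdeg]
  refine add ?_ (hg.smul ?_)
  · obtain ⟨r, hr, hg⟩ := hg
    rw [hg, map_sum, Finset.smul_sum]
    refine sum _ fun i _ => ?_
    rw [hsmul, smul_add, ← mul_smul, smul_comm D]
    refine add ?_ ?_
    · have hei : IsCombinationOfDegreeLE (R := R) e 0 (e i) := by
        refine ⟨fun l => if l = i then 1 else 0, fun l => ?_, by simp⟩
        dsimp only
        split_ifs <;> simp
      exact hei.smul (natDegree_mul_le_of_le hD ((hd _).trans (hr i)))
    · rw [add_comm]
      exact (he i).smul (hr i)
  · have : (-(n : R[X]) * d D).natDegree ≤ 0 + c := by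
      refine natDegree_mul_le_of_le ?_ ((hd D).trans hD)
      rw [natDegree_neg, natDegree_natCast]
    simpa using this

/-- Too many elements of bounded degree are linearly dependent. -/
lemma exists_linear_relation [IsDomain R] [IsDomain M] [FaithfulSMul R[X] M]
    {ι : Type*} [Fintype ι] {D : R[X]} (hD : D ≠ 0) {G : ι → M}
    (hG : ∀ i, IsCombinationOfDegreeLE (R := R) e j (D • G i))
    (hcard : m * (j + 1) < Fintype.card ι) :
    ∃ p : ι → R, p ≠ 0 ∧ ∑ i, C (p i) • G i = 0 := by
  choose r hr hrG using hG
  -- The unknowns `p i` must annihilate `j + 1` coefficients in each of `m` coordinates. More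
  -- unknowns than equations force a nonzero solution.
  let L : (ι → R) →ₗ[R] (Fin m × Fin (j + 1) → R) :=
    LinearMap.pi fun x => ∑ i, (r i x.1).coeff x.2 • LinearMap.proj i
  have hL : ¬ Function.Injective L := by
    intro h
    have := card_le_of_injective R L h
    simp at this
    omega
  rw [injective_iff_map_eq_zero] at hL
  push Not at hL
  obtain ⟨p, hp, hp0⟩ := hL
  refine ⟨p, hp0, ?_⟩
  have hcomb : ∀ l, ∑ i, C (p i) * r i l = 0 := by
    intro l
    ext a
    simp only [finsetSum_coeff, coeff_C_mul, coeff_zero]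
    rcases Nat.lt_or_ge a (j + 1) with ha | ha
    · have := congrFun hp (l, ⟨a, ha⟩)
      simpa [L, mul_comm] using this
    · refine Finset.sum_eq_zero fun i _ => ?_
      rw [coeff_eq_zero_of_natDegree_lt ((hr i l).trans_lt ha), mul_zero]
  have h : D • ∑ i, C (p i) • G i = 0 := by
    rw [Finset.smul_sum]
    simp_rw [smul_comm D, hrG, Finset.smul_sum, ← mul_smul]
    rw [Finset.sum_comm]
    simp_rw [← Finset.sum_smul, hcomb, zero_smul, Finset.sum_const_zero]
  rw [Algebra.smul_def] at h
  refine (mul_eq_zero.1 h).resolve_left ?_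
  rwa [FaithfulSMul.algebraMap_eq_zero_iff]

end IsCombinationOfDegreeLE

/-- The element `(δ - 1) (δ - 2) ⋯ (δ - n) F`. -/
def shiftedDescFactorial (δ : Derivation 𝕜 M M) (F : M) : ℕ → M
  | 0 => F
  | n + 1 => δ (shiftedDescFactorial δ F n) - (n + 1 : ℕ) • shiftedDescFactorial δ F n

/-- Lipshitz's elimination: an algebraic element satisfies a differential equation in which the
polynomial variable occurs only through powers compensated by falling factorials of `δ₂`. -/
theorem exists_elimination_relation [IsDomain R] [IsDomain M] [CharZero R] [FaithfulSMul R[X] M]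
    {δ₁ δ₂ : Derivation 𝕜 M M} {d₁ d₂ : Derivation 𝕜' R[X] R[X]}
    (hδ₁ : ∀ r, δ₁ (algebraMap R[X] M r) = algebraMap R[X] M (d₁ r))
    (hδ₂ : ∀ r, δ₂ (algebraMap R[X] M r) = algebraMap R[X] M (d₂ r))
    (hd₁ : ∀ r, (d₁ r).natDegree ≤ r.natDegree) (hd₂ : ∀ r, (d₂ r).natDegree ≤ r.natDegree)
    {F : M} (hF : IsAlgebraic R[X] F) :
    ∃ (N : ℕ) (p : Fin (N + 1) × Fin (N + 1) → R), p ≠ 0 ∧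
      ∑ i, C (p i) • (X ^ (N - i.2.val) : R[X]) •
        δ₁^[i.1.val] (shiftedDescFactorial δ₂ F i.2) = 0 := by
  obtain ⟨D, hD, W, hW, hFW, hδW⟩ := exists_finite_subalgebra_of_isAlgebraic
    (fun b : Bool => if b then δ₁ else δ₂) (fun b : Bool => if b then d₁ else d₂)
    (by rintro (_ | _) r; exacts [hδ₂ r, hδ₁ r]) hF
  obtain ⟨m, e, he⟩ := Submodule.fg_iff_exists_fin_generating_family.1 hW
  have hmem : ∀ x ∈ W, ∃ j, IsCombinationOfDegreeLE (R := R) e j x := fun x hx =>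
    IsCombinationOfDegreeLE.exists_of_mem_span (by rw [he]; exact hx)
  have heW : ∀ i, e i ∈ W := fun i => by
    rw [← Subalgebra.mem_toSubmodule, ← he]
    exact Submodule.subset_span ⟨i, rfl⟩
  choose j₁ hj₁ using fun i => hmem _ (hδW true (e i) (heW i))
  choose j₂ hj₂ using fun i => hmem _ (hδW false (e i) (heW i))
  obtain ⟨j₀, hj₀⟩ := hmem _ hFW
  simp only [if_true, Bool.false_eq_true, if_false] at hj₁ hj₂
  obtain ⟨c, hcD, hc0, hc1, hc2⟩ : ∃ c, D.natDegree ≤ c ∧ j₀ ≤ c ∧ (∀ i, j₁ i ≤ c) ∧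
      ∀ i, j₂ i ≤ c := by
    have h1 := fun i => Finset.single_le_sum (f := j₁) (fun _ _ => Nat.zero_le _)
      (Finset.mem_univ i)
    have h2 := fun i => Finset.single_le_sum (f := j₂) (fun _ _ => Nat.zero_le _)
      (Finset.mem_univ i)
    exact ⟨D.natDegree + j₀ + ∑ i, j₁ i + ∑ i, j₂ i, by omega, by omega,
      fun i => by have := h1 i; omega, fun i => by have := h2 i; omega⟩
  have hstep₁ : ∀ {n k g}, IsCombinationOfDegreeLE (R := R) e (c * n + k) (D ^ n • g) →
      IsCombinationOfDegreeLE (R := R) e (c * (n + 1) + k) (D ^ (n + 1) • δ₁ g) :=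
    fun h => h.derivation hcD hδ₁ hd₁ fun i => (hj₁ i).mono (hc1 i)
  have hstep₂ : ∀ {n k g}, IsCombinationOfDegreeLE (R := R) e (c * n + k) (D ^ n • g) →
      IsCombinationOfDegreeLE (R := R) e (c * (n + 1) + k) (D ^ (n + 1) • δ₂ g) :=
    fun h => h.derivation hcD hδ₂ hd₂ fun i => (hj₂ i).mono (hc2 i)
  have hmono : ∀ {n n' k g}, n ≤ n' → IsCombinationOfDegreeLE (R := R) e (c * n + k) (D ^ n • g) →
      IsCombinationOfDegreeLE (R := R) e (c * n' + k) (D ^ n' • g) := by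
    intro n n' k g hn h
    obtain ⟨l, rfl⟩ := Nat.exists_eq_add_of_le' hn
    rw [pow_add, mul_smul]
    refine (h.smul (natDegree_pow_le_of_le l hcD)).mono (le_of_eq ?_)
    ring
  have hfac : ∀ n, IsCombinationOfDegreeLE (R := R) e (c * (n + 1) + 0)
      (D ^ (n + 1) • shiftedDescFactorial δ₂ F n) := by
    intro n
    induction n with
    | zero => simpa [shiftedDescFactorial] using hj₀.mono hc0
    | succ n ih =>
      have h2 : D ^ (n + 1 + 1) • shiftedDescFactorial δ₂ F (n + 1) =
          D ^ (n + 1 + 1) • δ₂ (shiftedDescFactorial δ₂ F n) +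
          (-((n + 1 : ℕ) : R[X])) • D ^ (n + 1 + 1) • shiftedDescFactorial δ₂ F n := by
        rw [shiftedDescFactorial, smul_sub, ← Nat.cast_smul_eq_nsmul R[X],
          smul_comm (D ^ (n + 1 + 1)) ((n + 1 : ℕ) : R[X]), neg_smul, sub_eq_add_neg]
      rw [h2]
      refine (hstep₂ ih).add (((hmono (Nat.le_succ _) ih).smul (k := 0) ?_).mono (zero_add _).le)
      rw [natDegree_neg, natDegree_natCast]
  have hiter : ∀ b n, IsCombinationOfDegreeLE (R := R) e (c * (b + n + 1) + 0)
      (D ^ (b + n + 1) • δ₁^[b] (shiftedDescFactorial δ₂ F n)) := by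
    intro b n
    induction b with
    | zero => simpa using hfac n
    | succ b ih =>
      rw [Function.iterate_succ_apply', show b + 1 + n + 1 = b + n + 1 + 1 by ring]
      exact hstep₁ ih
  -- For `b, n ≤ N` the common denominator `D ^ (2N+1)` suffices, and the degrees are at most `N + c
  -- (2N+1)`. The number of equations grows with slope `m (2c+1)` in `N`; this `N` makes it at most
  -- `N (N+1)`, against `(N+1)²` unknowns.
  set N := m * (2 * c + 1) with hN
  refine ⟨N, IsCombinationOfDegreeLE.exists_linear_relation (e := e)
    (j := N + (c * (2 * N + 1) + 0)) (pow_ne_zero (2 * N + 1) hD) (fun i => ?_) ?_⟩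
  · rw [smul_comm]
    exact (hmono (by omega) (hiter i.1 i.2)).smul ((natDegree_X_pow_le _).trans (Nat.sub_le _ _))
  · simp only [Fintype.card_prod, Fintype.card_fin]
    calc m * (N + (c * (2 * N + 1) + 0) + 1) ≤ m * ((2 * c + 1) * (N + 1)) := by
          refine Nat.mul_le_mul_left _ ?_
          nlinarith
      _ = N * (N + 1) := by rw [hN]; ring
      _ < (N + 1) * (N + 1) := by nlinarith

end Filtration

/-! ### Euler derivations and D-finiteness. -/

section Euler

variable {σ : Type*}

/-- The Euler derivation `xᵢ ∂ᵢ` of formal power series. -/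
def eulerDerivation (i : σ) : Derivation ℚ (MvPowerSeries σ ℚ) (MvPowerSeries σ ℚ) :=
  (MvPowerSeries.X i : MvPowerSeries σ ℚ) • MvPowerSeries.pderiv ℚ i

lemma eulerDerivation_apply (i : σ) (f : MvPowerSeries σ ℚ) :
    eulerDerivation i f = MvPowerSeries.X i * MvPowerSeries.pderiv ℚ i f := rfl

lemma coeff_eulerDerivation (i : σ) (f : MvPowerSeries σ ℚ) (d : σ →₀ ℕ) :
    MvPowerSeries.coeff d (eulerDerivation i f) = d i * MvPowerSeries.coeff d f := by
  classical
  rw [eulerDerivation_apply, MvPowerSeries.X, MvPowerSeries.coeff_monomial_mul]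
  split_ifs with h
  · have h1 : 1 ≤ d i := by simpa using h i
    rw [MvPowerSeries.coeff_pderiv, tsub_add_cancel_of_le h, one_mul, mul_comm]
    congr 1
    rw [Finsupp.tsub_apply, Finsupp.single_eq_same]
    push_cast [h1]
    ring
  · have : d i = 0 := by
      by_contra h0
      apply h
      rw [Finsupp.single_le_iff]
      omega
    simp [this]

lemma eulerDerivation_monomial (i : σ) (d : σ →₀ ℕ) (r : ℚ) :
    eulerDerivation i (MvPowerSeries.monomial d r) = MvPowerSeries.monomial d (d i * r) := by
  classical
  ext e
  rw [coeff_eulerDerivation, MvPowerSeries.coeff_monomial, MvPowerSeries.coeff_monomial]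
  split_ifs with h
  · rw [h]
  · simp

end Euler

section DFinite

variable {σ : Type*}

lemma eulerDerivation_coe (i : σ) (p : MvPolynomial σ ℚ) :
    eulerDerivation i (p : MvPowerSeries σ ℚ) =
      ((MvPolynomial.X i * MvPolynomial.pderiv i p : MvPolynomial σ ℚ) : MvPowerSeries σ ℚ) := by
  rw [eulerDerivation_apply, MvPowerSeries.pderiv_coe]
  simp

lemma mvPolynomial_smul_eq (p : MvPolynomial σ ℚ) (f : MvPowerSeries σ ℚ) :
    p • f = (p : MvPowerSeries σ ℚ) * f := by
  rw [Algebra.smul_def, MvPowerSeries.algebraMap_apply']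
  simp

lemma eulerDerivation_mem_span {i : σ} {F : MvPowerSeries σ ℚ} {m : ℕ} {g : MvPowerSeries σ ℚ}
    (hg : g ∈ Submodule.span (MvPolynomial σ ℚ)
      ((fun b => (eulerDerivation i)^[b] F) '' Set.Iio m)) :
    eulerDerivation i g ∈ Submodule.span (MvPolynomial σ ℚ)
      ((fun b => (eulerDerivation i)^[b] F) '' Set.Iio (m + 1)) := by
  have hle : Submodule.span (MvPolynomial σ ℚ) ((fun b => (eulerDerivation i)^[b] F) '' Set.Iio m) ≤
      Submodule.span (MvPolynomial σ ℚ)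
        ((fun b => (eulerDerivation i)^[b] F) '' Set.Iio (m + 1)) :=
    Submodule.span_mono (Set.image_mono (Set.Iio_subset_Iio (Nat.le_succ m)))
  induction hg using Submodule.span_induction with
  | mem x hx =>
    obtain ⟨b, hb, rfl⟩ := hx
    refine Submodule.subset_span ⟨b + 1, Nat.succ_lt_succ hb, ?_⟩
    simp only [Function.iterate_succ_apply']
  | zero => simp
  | add x y _ _ hx hy => rw [map_add]; exact add_mem hx hy
  | smul p x hx' hx =>
    rw [mvPolynomial_smul_eq, Derivation.leibniz, smul_eq_mul, smul_eq_mul, eulerDerivation_coe,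
      mul_comm x, ← mvPolynomial_smul_eq, ← mvPolynomial_smul_eq]
    exact add_mem (Submodule.smul_mem _ _ hx) (Submodule.smul_mem _ _ (hle hx'))

/-- With `θ = x ∂`, this follows from `x^(m+1) ∂^(m+1) = (θ - m) x^m ∂^m`. -/
lemma X_pow_mul_pderiv_iterate_mem_span (i : σ) (F : MvPowerSeries σ ℚ) (m : ℕ) :
    (MvPolynomial.X i ^ m : MvPolynomial σ ℚ) • (MvPowerSeries.pderiv ℚ i)^[m] F ∈
      Submodule.span (MvPolynomial σ ℚ)
        ((fun b => (eulerDerivation i)^[b] F) '' Set.Iio (m + 1)) := by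
  induction m with
  | zero => exact Submodule.subset_span ⟨0, by simp, by simp⟩
  | succ m ih =>
    have h : (MvPolynomial.X i ^ (m + 1) : MvPolynomial σ ℚ) •
        (MvPowerSeries.pderiv ℚ i)^[m + 1] F =
        eulerDerivation i ((MvPolynomial.X i ^ m : MvPolynomial σ ℚ) •
          (MvPowerSeries.pderiv ℚ i)^[m] F) -
        (m : MvPolynomial σ ℚ) • ((MvPolynomial.X i ^ m : MvPolynomial σ ℚ) •
          (MvPowerSeries.pderiv ℚ i)^[m] F) := by
      simp only [mvPolynomial_smul_eq, eulerDerivation_apply, Function.iterate_succ_apply',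
        Derivation.leibniz, smul_eq_mul, MvPolynomial.coe_pow, MvPolynomial.coe_X,
        MvPowerSeries.pderiv_pow, MvPowerSeries.pderiv_X_self]
      rw [show ((m : MvPolynomial σ ℚ) : MvPowerSeries σ ℚ) = (m : MvPowerSeries σ ℚ) from
        map_natCast (MvPolynomial.coeToMvPowerSeries.ringHom (σ := σ) (R := ℚ)) m]
      cases m with
      | zero => simp
      | succ m => simp only [Nat.add_sub_cancel]; ring
    rw [h]
    exact sub_mem (eulerDerivation_mem_span ih) (Submodule.smul_mem _ _
      (Submodule.span_mono (Set.image_mono (Set.Iio_subset_Iio (Nat.le_succ _))) ih))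

/-- A series that satisfies a non-trivial linear differential equation in `xᵢ ∂ᵢ` with polynomial
coefficients is D-finite with respect to `xᵢ`. -/
theorem isDFiniteIn_of_relation {i : σ} {F : MvPowerSeries σ ℚ} {N : ℕ}
    {p : Fin N → MvPolynomial σ ℚ} (hp : p ≠ 0)
    (h : ∑ b, p b • (eulerDerivation i)^[b.val] F = 0) : IsDFiniteIn i F := by
  classical
  set u : ℕ → MvPowerSeries σ ℚ := fun b => (eulerDerivation i)^[b] F with hu
  set L := FractionRing (MvPowerSeries σ ℚ)
  set κ := FractionRing (MvPolynomial σ ℚ)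
  have hne : (Finset.univ.filter fun b => p b ≠ 0).Nonempty := by
    obtain ⟨b, hb⟩ := Function.ne_iff.1 hp
    exact ⟨b, by simpa using hb⟩
  obtain ⟨B, hB, hmax⟩ := Finset.exists_max_image _ (fun b : Fin N => b) hne
  simp only [Finset.mem_filter, Finset.mem_univ, true_and] at hB hmax
  have hbase : p B • u B ∈ Submodule.span (MvPolynomial σ ℚ) (u '' Set.Iio B.val) := by
    rw [← Finset.add_sum_erase _ _ (Finset.mem_univ B)] at h
    rw [hu]
    dsimp only
    rw [eq_neg_of_add_eq_zero_left h]
    refine neg_mem (Submodule.sum_mem _ fun b hb => ?_)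
    by_cases hb0 : p b = 0
    · simp [hb0]
    · refine Submodule.smul_mem _ _ (Submodule.subset_span ⟨b, ?_, rfl⟩)
      exact lt_of_le_of_ne (hmax b hb0) (Finset.ne_of_mem_erase hb)
  have hrec : ∀ k, p B • u (B + k) ∈
      Submodule.span (MvPolynomial σ ℚ) (u '' Set.Iio (B.val + k)) := by
    intro k
    induction k with
    | zero => exact hbase
    | succ k ih =>
      have h1 := eulerDerivation_mem_span ih
      rw [mvPolynomial_smul_eq, Derivation.leibniz, smul_eq_mul, smul_eq_mul,
        ← mvPolynomial_smul_eq, eulerDerivation_coe, mul_comm, ← mvPolynomial_smul_eq] at h1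
      have h2 : eulerDerivation i (u (B + k)) = u (B + (k + 1)) := by
        simp only [hu]
        rw [← Function.iterate_succ_apply' (eulerDerivation i)]
        rfl
      rw [h2] at h1
      have h3 : u (B + k) ∈ Submodule.span (MvPolynomial σ ℚ) (u '' Set.Iio (B.val + k + 1)) :=
        Submodule.subset_span ⟨B + k, Nat.lt_succ_self _, rfl⟩
      exact (Submodule.add_mem_iff_left _ (Submodule.smul_mem _ _ h3)).1 h1
  set V : Submodule κ L :=
    Submodule.span κ ((fun b => algebraMap (MvPowerSeries σ ℚ) L (u b)) '' Set.Iio B.val) with hV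
  have hsmul : ∀ (q : MvPolynomial σ ℚ) (g : MvPowerSeries σ ℚ),
      algebraMap (MvPowerSeries σ ℚ) L (q • g) =
        algebraMap (MvPolynomial σ ℚ) κ q • algebraMap (MvPowerSeries σ ℚ) L g := by
    intro q g
    rw [algebraMap_smul, Algebra.smul_def, map_mul, ← IsScalarTower.algebraMap_apply,
      ← Algebra.smul_def]
  have hspan : ∀ m, (∀ b < m, algebraMap (MvPowerSeries σ ℚ) L (u b) ∈ V) →
      ∀ g ∈ Submodule.span (MvPolynomial σ ℚ) (u '' Set.Iio m),
        algebraMap (MvPowerSeries σ ℚ) L g ∈ V := by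
    intro m hm g hg
    induction hg using Submodule.span_induction with
    | mem x hx => obtain ⟨b, hb, rfl⟩ := hx; exact hm b hb
    | zero => simp
    | add x y _ _ hx hy => rw [map_add]; exact add_mem hx hy
    | smul q x _ hx => rw [hsmul]; exact Submodule.smul_mem _ _ hx
  have hdiv : ∀ (q : MvPolynomial σ ℚ) (g : MvPowerSeries σ ℚ), q ≠ 0 →
      algebraMap (MvPowerSeries σ ℚ) L (q • g) ∈ V → algebraMap (MvPowerSeries σ ℚ) L g ∈ V := by
    intro q g hq hg
    rw [hsmul] at hg
    refine (Submodule.smul_mem_iff _ ?_).1 hg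
    rwa [Ne, FaithfulSMul.algebraMap_eq_zero_iff]
  have hall : ∀ m, algebraMap (MvPowerSeries σ ℚ) L (u m) ∈ V := by
    intro m
    induction m using Nat.strong_induction_on with
    | _ m ih =>
      rcases Nat.lt_or_ge m B with hm | hm
      · exact Submodule.subset_span ⟨m, hm, rfl⟩
      · obtain ⟨k, rfl⟩ := Nat.exists_eq_add_of_le hm
        exact hdiv _ _ hB (hspan _ ih _ (hrec k))
  have hfin : FiniteDimensional κ V :=
    FiniteDimensional.span_of_finite κ ((Set.finite_Iio _).image _)
  refine Submodule.finiteDimensional_of_le (S₂ := V) (Submodule.span_le.2 ?_)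
  rintro _ ⟨m, rfl⟩
  exact hdiv _ _ (pow_ne_zero m (MvPolynomial.X_ne_zero i))
    (hspan _ (fun b _ => hall b) _ (X_pow_mul_pderiv_iterate_mem_span i F m))

end DFinite

/-! ### The substitution `t = τ w` and extraction of the coefficient of `w ^ 0`. -/

section DiagonalVariables

/-- The exponent of `τ, w, x, y` in the monomial `x ^ e₀ y ^ e₁ t ^ e₂ w ^ k`, where `t = τ w`. -/
def slopeExponent (e : Fin 3 →₀ ℕ) (k : ℕ) : Fin 4 →₀ ℕ :=
  Finsupp.equivFunOnFinite.symm ![e 2, e 2 + k, e 0, e 1]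

@[simp] lemma slopeExponent_zero (e : Fin 3 →₀ ℕ) (k : ℕ) : slopeExponent e k 0 = e 2 := rfl
@[simp] lemma slopeExponent_one (e : Fin 3 →₀ ℕ) (k : ℕ) : slopeExponent e k 1 = e 2 + k := rfl
@[simp] lemma slopeExponent_two (e : Fin 3 →₀ ℕ) (k : ℕ) : slopeExponent e k 2 = e 0 := rfl
@[simp] lemma slopeExponent_three (e : Fin 3 →₀ ℕ) (k : ℕ) : slopeExponent e k 3 = e 1 := rfl

lemma slopeExponent_injective {e e' : Fin 3 →₀ ℕ} {k k' : ℕ}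
    (h : slopeExponent e k = slopeExponent e' k') : e = e' ∧ k = k' := by
  have h0 := DFunLike.congr_fun h 0
  have h1 := DFunLike.congr_fun h 1
  have h2 := DFunLike.congr_fun h 2
  have h3 := DFunLike.congr_fun h 3
  simp only [slopeExponent_zero, slopeExponent_one, slopeExponent_two, slopeExponent_three]
    at h0 h1 h2 h3
  refine ⟨?_, by omega⟩
  ext i
  fin_cases i <;> assumption

/-- The substitution `t = τ w` in polynomials in `w` over `ℚ[x, y, t]`, with values in
`ℚ[τ, w, x, y]`. -/
def slopeHom : Polynomial (MvPolynomial (Fin 3) ℚ) →+* MvPolynomial (Fin 4) ℚ :=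
  Polynomial.eval₂RingHom (MvPolynomial.aeval (R := ℚ)
    ![MvPolynomial.X 2, MvPolynomial.X 3, MvPolynomial.X 0 * MvPolynomial.X 1]).toRingHom
    (MvPolynomial.X 1)

lemma slopeHom_monomial (k : ℕ) (e : Fin 3 →₀ ℕ) (r : ℚ) :
    slopeHom (Polynomial.monomial k (MvPolynomial.monomial e r)) =
      MvPolynomial.monomial (slopeExponent e k) r := by
  simp only [slopeHom, Polynomial.coe_eval₂RingHom, Polynomial.eval₂_monomial,
    AlgHom.toRingHom_eq_coe, RingHom.coe_coe, MvPolynomial.aeval_monomial]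
  rw [MvPolynomial.monomial_eq (s := slopeExponent e k), Finsupp.prod_fintype _ _ (by simp),
    Finsupp.prod_fintype _ _ (by simp), Fin.prod_univ_three, Fin.prod_univ_four]
  simp
  ring

lemma slope_induction {P : Polynomial (MvPolynomial (Fin 3) ℚ) → Prop}
    (add : ∀ p q, P p → P q → P (p + q))
    (monomial : ∀ k e r, P (Polynomial.monomial k (MvPolynomial.monomial e r))) (p) : P p := by
  induction p using Polynomial.induction_on' with
  | add p q hp hq => exact add p q hp hq
  | monomial k a =>
    induction a using MvPolynomial.induction_on' with
    | monomial e r => exact monomial k e r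
    | add f g hf hg => rw [map_add]; exact add _ _ hf hg

lemma slopeHom_injective : Function.Injective slopeHom := by
  have h : ∀ p e k, (slopeHom p).coeff (slopeExponent e k) = (p.coeff k).coeff e := by
    intro p e k
    induction p using slope_induction with
    | add p q hp hq => simp [hp, hq]
    | monomial k' e' r =>
      rw [slopeHom_monomial, MvPolynomial.coeff_monomial, Polynomial.coeff_monomial]
      by_cases hk : k' = k
      · by_cases he : e' = e
        · simp [hk, he]
        · rw [if_neg (fun h => he (slopeExponent_injective h).1), if_pos hk,
            MvPolynomial.coeff_monomial, if_neg he]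
      · rw [if_neg (fun h => hk (slopeExponent_injective h).2), if_neg hk, MvPolynomial.coeff_zero]
  intro p q hpq
  ext k e
  rw [← h, hpq, h]

/-- The algebra structure on `ℚ⟦τ, w, x, y⟧` over `ℚ[x, y, t][w]` given by `t = τ w`. -/
@[reducible] def slopeAlgebra :
    Algebra (Polynomial (MvPolynomial (Fin 3) ℚ)) (MvPowerSeries (Fin 4) ℚ) :=
  ((algebraMap (MvPolynomial (Fin 4) ℚ) (MvPowerSeries (Fin 4) ℚ)).comp slopeHom).toAlgebra

attribute [local instance] slopeAlgebra

lemma slopeAlgebra_algebraMap (p : Polynomial (MvPolynomial (Fin 3) ℚ)) :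
    algebraMap (Polynomial (MvPolynomial (Fin 3) ℚ)) (MvPowerSeries (Fin 4) ℚ) p =
      (slopeHom p : MvPowerSeries (Fin 4) ℚ) := by
  change algebraMap (MvPolynomial (Fin 4) ℚ) (MvPowerSeries (Fin 4) ℚ) (slopeHom p) = _
  rw [MvPowerSeries.algebraMap_apply']
  simp

lemma slopeAlgebra_algebraMap_monomial (k : ℕ) (e : Fin 3 →₀ ℕ) (r : ℚ) :
    algebraMap (Polynomial (MvPolynomial (Fin 3) ℚ)) (MvPowerSeries (Fin 4) ℚ)
      (Polynomial.monomial k (MvPolynomial.monomial e r)) =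
        MvPowerSeries.monomial (slopeExponent e k) r := by
  rw [slopeAlgebra_algebraMap, slopeHom_monomial, MvPolynomial.coe_monomial]

instance faithfulSMul_slopeAlgebra :
    FaithfulSMul (Polynomial (MvPolynomial (Fin 3) ℚ)) (MvPowerSeries (Fin 4) ℚ) := by
  rw [faithfulSMul_iff_algebraMap_injective]
  exact (FaithfulSMul.algebraMap_injective (MvPolynomial (Fin 4) ℚ) _).comp slopeHom_injective

/-- A series in `τ, w, x, y` that is algebraic is algebraic over `ℚ[x, y, t][w]`, `t = τ w`. -/
lemma IsAlgebraicSeries.isAlgebraic_slope {F : MvPowerSeries (Fin 4) ℚ}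
    (hF : IsAlgebraicSeries F) : IsAlgebraic (Polynomial (MvPolynomial (Fin 3) ℚ)) F := by
  let : Algebra (Polynomial (MvPolynomial (Fin 3) ℚ)) (MvPolynomial (Fin 4) ℚ) :=
    slopeHom.toAlgebra
  have : IsScalarTower (Polynomial (MvPolynomial (Fin 3) ℚ)) (MvPolynomial (Fin 4) ℚ)
      (MvPowerSeries (Fin 4) ℚ) := IsScalarTower.of_algebraMap_eq fun _ => rfl
  have hX : ∀ (s : Fin 4 →₀ ℕ) (e : Fin 3 →₀ ℕ) (k : ℕ) (r : ℚ),
      (∀ i, slopeExponent e k i = s i) →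
      IsAlgebraic (Polynomial (MvPolynomial (Fin 3) ℚ)) (MvPolynomial.monomial s r) := by
    intro s e k r hs
    rw [← Finsupp.ext hs, ← slopeHom_monomial]
    exact isAlgebraic_algebraMap (A := MvPolynomial (Fin 4) ℚ)
      (Polynomial.monomial k (MvPolynomial.monomial e r))
  have hX1 : IsAlgebraic (Polynomial (MvPolynomial (Fin 3) ℚ))
      (MvPolynomial.X 1 : MvPolynomial (Fin 4) ℚ) :=
    hX (Finsupp.single 1 1) 0 1 1 fun i => by fin_cases i <;> simp
  have : Algebra.IsAlgebraic (Polynomial (MvPolynomial (Fin 3) ℚ)) (MvPolynomial (Fin 4) ℚ) := by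
    constructor
    intro p
    induction p using MvPolynomial.induction_on with
    | C a => exact hX 0 0 0 a fun i => by fin_cases i <;> simp
    | add p q hp hq => exact hp.add hq
    | mul_X p i hp =>
      refine hp.mul ?_
      fin_cases i
      -- `τ` is not in the image of `slopeHom`, but it is algebraic because `w ≠ 0` and `τ w = t`
      -- are.
      · refine IsAlgebraic.of_mul (y := MvPolynomial.X 1)
          (mem_nonZeroDivisors_of_ne_zero (MvPolynomial.X_ne_zero _)) hX1 ?_
        simp only [MvPolynomial.X, MvPolynomial.monomial_mul, mul_one]
        exact hX _ (Finsupp.single 2 1) 0 1 fun i => by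
          fin_cases i <;> simp
      · exact hX1
      · exact hX _ (Finsupp.single 0 1) 0 1 fun i => by
          fin_cases i <;> simp
      · exact hX _ (Finsupp.single 1 1) 0 1 fun i => by
          fin_cases i <;> simp
  exact IsAlgebraic.restrictScalars (Polynomial (MvPolynomial (Fin 3) ℚ))
    (S := MvPolynomial (Fin 4) ℚ) hF

/-- The variable among `τ, w, x, y` whose Euler derivation represents that of the given variable
among `x, y, t`. -/
def slopeVariable : Fin 3 → Fin 4 := ![2, 3, 0]

lemma slopeExponent_slopeVariable (e : Fin 3 →₀ ℕ) (k : ℕ) (z : Fin 3) :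
    slopeExponent e k (slopeVariable z) = e z := by
  fin_cases z <;> rfl

/-- The derivation `w ∂_w` at constant `t = τ w`. -/
def slopeDerivation : Derivation ℚ (MvPowerSeries (Fin 4) ℚ) (MvPowerSeries (Fin 4) ℚ) :=
  eulerDerivation 1 - eulerDerivation 0

/-- The derivation `z ∂_z` acting on the coefficients of a polynomial. -/
def eulerCoeffs (z : Fin 3) :
    Derivation ℤ (Polynomial (MvPolynomial (Fin 3) ℚ)) (Polynomial (MvPolynomial (Fin 3) ℚ)) :=
  let : Differential (MvPolynomial (Fin 3) ℚ) :=
    ⟨((MvPolynomial.X z : MvPolynomial (Fin 3) ℚ) • MvPolynomial.pderiv z).restrictScalars ℤ⟩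
  Differential.mapCoeffs

lemma coeff_eulerCoeffs (z : Fin 3) (p : Polynomial (MvPolynomial (Fin 3) ℚ)) (k : ℕ) :
    (eulerCoeffs z p).coeff k = MvPolynomial.X z * MvPolynomial.pderiv z (p.coeff k) := rfl

lemma natDegree_eulerCoeffs_le (z : Fin 3) (p : Polynomial (MvPolynomial (Fin 3) ℚ)) :
    (eulerCoeffs z p).natDegree ≤ p.natDegree := by
  rw [Polynomial.natDegree_le_iff_coeff_eq_zero]
  intro k hk
  rw [coeff_eulerCoeffs, Polynomial.coeff_eq_zero_of_natDegree_lt hk, map_zero, mul_zero]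

lemma eulerDerivation_algebraMap (z : Fin 3) (p : Polynomial (MvPolynomial (Fin 3) ℚ)) :
    eulerDerivation (slopeVariable z) (algebraMap _ (MvPowerSeries (Fin 4) ℚ) p) =
      algebraMap _ (MvPowerSeries (Fin 4) ℚ) (eulerCoeffs z p) := by
  induction p using slope_induction with
  | add p q hp hq => simp only [map_add, hp, hq]
  | monomial k e r =>
    have : eulerCoeffs z (Polynomial.monomial k (MvPolynomial.monomial e r)) =
        Polynomial.monomial k (MvPolynomial.monomial e (e z * r)) := by
      ext1 l
      rw [coeff_eulerCoeffs, Polynomial.coeff_monomial, Polynomial.coeff_monomial]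
      split_ifs
      · rw [MvPolynomial.X_mul_pderiv_monomial, MvPolynomial.smul_monomial, nsmul_eq_mul]
      · simp
    rw [this, slopeAlgebra_algebraMap_monomial, slopeAlgebra_algebraMap_monomial,
      eulerDerivation_monomial, slopeExponent_slopeVariable]

/-- The derivation `w ∂_w` of polynomials in `w`. -/
def eulerPolynomial :
    Derivation ℤ (Polynomial (MvPolynomial (Fin 3) ℚ)) (Polynomial (MvPolynomial (Fin 3) ℚ)) :=
  ((Polynomial.X : Polynomial (MvPolynomial (Fin 3) ℚ)) •
    Polynomial.derivative').restrictScalars ℤ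

lemma coeff_eulerPolynomial (p : Polynomial (MvPolynomial (Fin 3) ℚ)) (k : ℕ) :
    (eulerPolynomial p).coeff k = k * p.coeff k := by
  change (Polynomial.X * Polynomial.derivative p).coeff k = _
  cases k with
  | zero => simp
  | succ k =>
    rw [Polynomial.coeff_X_mul, Polynomial.coeff_derivative]
    push_cast
    ring

lemma natDegree_eulerPolynomial_le (p : Polynomial (MvPolynomial (Fin 3) ℚ)) :
    (eulerPolynomial p).natDegree ≤ p.natDegree := by
  rw [Polynomial.natDegree_le_iff_coeff_eq_zero]
  intro k hk
  rw [coeff_eulerPolynomial, Polynomial.coeff_eq_zero_of_natDegree_lt hk, mul_zero]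

lemma slopeDerivation_algebraMap (p : Polynomial (MvPolynomial (Fin 3) ℚ)) :
    slopeDerivation (algebraMap _ (MvPowerSeries (Fin 4) ℚ) p) =
      algebraMap _ (MvPowerSeries (Fin 4) ℚ) (eulerPolynomial p) := by
  induction p using slope_induction with
  | add p q hp hq => simp only [map_add, hp, hq]
  | monomial k e r =>
    have : eulerPolynomial (Polynomial.monomial k (MvPolynomial.monomial e r)) =
        Polynomial.monomial k (MvPolynomial.monomial e (k * r)) := by
      ext1 l
      rw [coeff_eulerPolynomial, Polynomial.coeff_monomial, Polynomial.coeff_monomial]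
      split_ifs with h
      · rw [← h, ← nsmul_eq_mul, ← nsmul_eq_mul, MvPolynomial.smul_monomial]
      · simp
    rw [this, slopeAlgebra_algebraMap_monomial, slopeAlgebra_algebraMap_monomial,
      slopeDerivation, Derivation.sub_apply, eulerDerivation_monomial, eulerDerivation_monomial,
      ← map_sub]
    congr 1
    simp
    ring

/-- The coefficient of `w ^ k`, as a series in `x, y, t`, of a series in `x, y, t = τ w, w`. -/
def slopeCoeff (k : ℕ) : MvPowerSeries (Fin 4) ℚ →+ MvPowerSeries (Fin 3) ℚ where
  toFun f := fun e => MvPowerSeries.coeff (slopeExponent e k) f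
  map_zero' := rfl
  map_add' _ _ := rfl

lemma coeff_slopeCoeff (k : ℕ) (f : MvPowerSeries (Fin 4) ℚ) (e : Fin 3 →₀ ℕ) :
    MvPowerSeries.coeff e (slopeCoeff k f) = MvPowerSeries.coeff (slopeExponent e k) f := rfl

lemma slopeCoeff_C_smul (k : ℕ) (p : MvPolynomial (Fin 3) ℚ) (f : MvPowerSeries (Fin 4) ℚ) :
    slopeCoeff k ((Polynomial.C p : Polynomial (MvPolynomial (Fin 3) ℚ)) • f) =
      p • slopeCoeff k f := by
  classical
  induction p using MvPolynomial.induction_on' with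
  | add p q hp hq => rw [Polynomial.C_add, Algebra.smul_def, map_add, add_mul, ← Algebra.smul_def,
      ← Algebra.smul_def, map_add, hp, hq, add_smul]
  | monomial e r =>
    rw [Algebra.smul_def, ← Polynomial.monomial_zero_left, slopeAlgebra_algebraMap_monomial,
      mvPolynomial_smul_eq, MvPolynomial.coe_monomial]
    ext e'
    rw [coeff_slopeCoeff, MvPowerSeries.coeff_monomial_mul, MvPowerSeries.coeff_monomial_mul,
      coeff_slopeCoeff]
    have hle : slopeExponent e 0 ≤ slopeExponent e' k ↔ e ≤ e' := by
      constructor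
      · intro h i
        rw [← slopeExponent_slopeVariable e 0, ← slopeExponent_slopeVariable e' k]
        exact h _
      · intro h i
        have h0 := h 0
        have h1 := h 1
        have h2 := h 2
        fin_cases i <;> simp <;> omega
    simp only [hle]
    split_ifs with h
    · have hsub : slopeExponent e' k - slopeExponent e 0 = slopeExponent (e' - e) k := by
        ext i
        have h2 := h 2
        fin_cases i <;> simp
        omega
      rw [hsub]
    · rfl

/-- Negative powers of `w` do occur in terms of `t` and `w`, but `slopeCoeff` reads only the others;
`c ≤ k` keeps the index there. -/
lemma slopeCoeff_X_pow_smul {k c : ℕ} (h : c ≤ k) (f : MvPowerSeries (Fin 4) ℚ) :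
    slopeCoeff k ((Polynomial.X ^ c : Polynomial (MvPolynomial (Fin 3) ℚ)) • f) =
      slopeCoeff (k - c) f := by
  classical
  have h1 : (Polynomial.X ^ c : Polynomial (MvPolynomial (Fin 3) ℚ)) =
      Polynomial.monomial c (MvPolynomial.monomial 0 1) := by
    rw [Polynomial.X_pow_eq_monomial]
    rfl
  rw [Algebra.smul_def, h1, slopeAlgebra_algebraMap_monomial]
  ext e
  rw [coeff_slopeCoeff, MvPowerSeries.coeff_monomial_mul, coeff_slopeCoeff, if_pos, one_mul]
  · have hsub : slopeExponent e k - slopeExponent 0 c = slopeExponent e (k - c) := by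
      ext i
      fin_cases i <;> simp
      omega
    rw [hsub]
  · intro i
    fin_cases i <;> simp
    omega

lemma slopeCoeff_eulerDerivation (k : ℕ) (z : Fin 3) (f : MvPowerSeries (Fin 4) ℚ) :
    slopeCoeff k (eulerDerivation (slopeVariable z) f) = eulerDerivation z (slopeCoeff k f) := by
  ext e
  rw [coeff_slopeCoeff, coeff_eulerDerivation, coeff_eulerDerivation, coeff_slopeCoeff,
    slopeExponent_slopeVariable]

lemma slopeCoeff_eulerDerivation_iterate (k : ℕ) (z : Fin 3) (b : ℕ)
    (f : MvPowerSeries (Fin 4) ℚ) :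
    slopeCoeff k ((eulerDerivation (slopeVariable z))^[b] f) =
      (eulerDerivation z)^[b] (slopeCoeff k f) := by
  induction b with
  | zero => rfl
  | succ b ih =>
    rw [Function.iterate_succ_apply', Function.iterate_succ_apply', slopeCoeff_eulerDerivation, ih]

lemma slopeCoeff_slopeDerivation (k : ℕ) (f : MvPowerSeries (Fin 4) ℚ) :
    slopeCoeff k (slopeDerivation f) = (k : ℤ) • slopeCoeff k f := by
  ext e
  rw [coeff_slopeCoeff, slopeDerivation, Derivation.sub_apply, map_sub, coeff_eulerDerivation,
    coeff_eulerDerivation, map_zsmul, coeff_slopeCoeff]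
  simp
  ring

/-- The point is that the scalar vanishes for `1 ≤ k ≤ n` but not for `k = 0`. -/
lemma slopeCoeff_shiftedDescFactorial (k n : ℕ) (f : MvPowerSeries (Fin 4) ℚ) :
    slopeCoeff k (shiftedDescFactorial slopeDerivation f n) =
      (∏ i ∈ Finset.range n, ((k : ℤ) - (i + 1))) • slopeCoeff k f := by
  induction n with
  | zero => simp [shiftedDescFactorial]
  | succ n ih =>
    rw [shiftedDescFactorial, map_sub, slopeCoeff_slopeDerivation, map_nsmul, ih,
      Finset.prod_range_succ, ← natCast_zsmul, ← mul_smul, ← mul_smul, ← sub_smul]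
    congr 1
    push_cast
    ring

/-- If a series in `τ, w, x, y` is algebraic, then its part independent of `w`, as a series in
`x, y, t = τ w`, is D-finite. -/
theorem isDFinite_slopeCoeff_zero {F : MvPowerSeries (Fin 4) ℚ} (hF : IsAlgebraicSeries F) :
    IsDFinite (slopeCoeff 0 F) := by
  classical
  intro z
  have : IsDomain (MvPowerSeries (Fin 4) ℚ) := NoZeroDivisors.to_isDomain _
  obtain ⟨N, p, hp, hrel⟩ := exists_elimination_relation (eulerDerivation_algebraMap z)
    slopeDerivation_algebraMap (natDegree_eulerCoeffs_le z) natDegree_eulerPolynomial_le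
    hF.isAlgebraic_slope
  have hne : (Finset.univ.filter fun i => p i ≠ 0).Nonempty := by
    obtain ⟨i, hi⟩ := Function.ne_iff.1 hp
    exact ⟨i, by simpa using hi⟩
  obtain ⟨⟨b₀, c₀⟩, hi₀, hmin⟩ := Finset.exists_min_image _ (fun i => i.2) hne
  simp only [Finset.mem_filter, Finset.mem_univ, true_and] at hi₀ hmin
  have hne0 : (∏ i ∈ Finset.range c₀.val, (((0 : ℕ) : ℤ) - (i + 1))) ≠ 0 :=
    Finset.prod_ne_zero_iff.2 fun i _ => by push_cast; omega
  -- In this coefficient the term `(b, c)` involves `slopeCoeff (c - c₀) F`, whose scalar is zero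
  -- unless `c = c₀`.
  have h := congrArg (slopeCoeff (N - c₀)) hrel
  rw [map_zero, map_sum] at h
  have hterm : ∀ i : Fin (N + 1) × Fin (N + 1), slopeCoeff (N - c₀)
      (Polynomial.C (p i) • (Polynomial.X ^ (N - i.2.val) :
        Polynomial (MvPolynomial (Fin 3) ℚ)) • (eulerDerivation (slopeVariable z))^[i.1.val]
          (shiftedDescFactorial slopeDerivation F i.2)) =
      if i.2 = c₀ then (∏ i ∈ Finset.range c₀.val, (((0 : ℕ) : ℤ) - (i + 1))) •
        (p i • (eulerDerivation z)^[i.1.val] (slopeCoeff 0 F)) else 0 := by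
    rintro ⟨b, c⟩
    rw [slopeCoeff_C_smul]
    have hc : p (b, c) = 0 ∨ c₀ ≤ c := or_iff_not_imp_left.2 fun h => hmin (b, c) h
    rcases hc with hc | hc
    · simp [hc]
    · have hcv : c₀.val ≤ c.val := hc
      dsimp only
      rw [slopeCoeff_X_pow_smul (Nat.sub_le_sub_left hcv N),
        slopeCoeff_eulerDerivation_iterate, slopeCoeff_shiftedDescFactorial]
      have hsmul : ∀ (m : ℤ) (f : MvPowerSeries (Fin 3) ℚ),
          (eulerDerivation z)^[b.val] (m • f) = m • (eulerDerivation z)^[b.val] f := by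
        intro m f
        induction b.val with
        | zero => rfl
        | succ b ih => rw [Function.iterate_succ_apply', ih, map_zsmul, Function.iterate_succ_apply']
      rw [hsmul]
      have : N - c₀.val - (N - c.val) = c.val - c₀.val := by
        have := c.2; omega
      rw [this]
      split_ifs with hcc
      · obtain rfl : c = c₀ := hcc
        rw [Nat.sub_self, smul_comm]
      · have hlt : c₀.val < c.val := lt_of_le_of_ne hc fun h => hcc (Fin.ext h.symm)
        rw [Finset.prod_eq_zero (i := c.val - c₀.val - 1) (Finset.mem_range.2 (by omega)) (by
          rw [Nat.sub_sub, Nat.cast_sub hcv, Nat.cast_sub (by omega : c₀.val + 1 ≤ c.val)]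
          push_cast
          ring), zero_smul, smul_zero]
  simp_rw [hterm] at h
  refine isDFiniteIn_of_relation (p := fun b => p (b, c₀)) (Function.ne_iff.2 ⟨b₀, hi₀⟩) ?_
  rw [← Finset.univ_product_univ, Finset.sum_product] at h
  simp only [Finset.sum_ite_eq', Finset.mem_univ, if_true] at h
  rw [← Finset.smul_sum] at h
  rw [← Int.cast_smul_eq_zsmul ℚ] at h
  exact (smul_eq_zero.1 h).resolve_left (Int.cast_ne_zero.2 hne0)

end DiagonalVariables

/-! ### From iterated polynomial and series rings to several variables. -/

section Transport

variable {S : Type*} [CommRing S] {n : ℕ}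

/-- An embedding of a ring in `ℚ[z₀, …]` induces an embedding of its ring of polynomials in a
polynomial ring with one more variable, which comes first. -/
def polynomialEmbedding (ρ : S →+* MvPolynomial (Fin n) ℚ) :
    Polynomial S →+* MvPolynomial (Fin (n + 1)) ℚ :=
  (MvPolynomial.finSuccEquiv ℚ n).symm.toRingEquiv.toRingHom.comp (Polynomial.mapRingHom ρ)

lemma coeff_polynomialEmbedding (ρ : S →+* MvPolynomial (Fin n) ℚ) (p : Polynomial S)
    (d : Fin (n + 1) →₀ ℕ) :
    (polynomialEmbedding ρ p).coeff d = (ρ (p.coeff (d 0))).coeff d.tail := by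
  conv_lhs => rw [← Finsupp.cons_tail d]
  rw [← MvPolynomial.finSuccEquiv_coeff_coeff]
  simp [polynomialEmbedding]

lemma polynomialEmbedding_injective {ρ : S →+* MvPolynomial (Fin n) ℚ}
    (hρ : Function.Injective ρ) : Function.Injective (polynomialEmbedding ρ) :=
  (MvPolynomial.finSuccEquiv ℚ n).symm.injective.comp (Polynomial.map_injective ρ hρ)

/-- An embedding of a ring in `ℚ[z₀, …]` induces an embedding of its ring of power series in a
power series ring with one more variable, which comes first. -/
def seriesEmbedding (ρ : S →+* MvPolynomial (Fin n) ℚ) :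
    PowerSeries S →+* MvPowerSeries (Fin (n + 1)) ℚ :=
  (MvPowerSeries.finSuccEquiv ℚ n).symm.toRingEquiv.toRingHom.comp
    (PowerSeries.map (MvPolynomial.coeToMvPowerSeries.ringHom.comp ρ))

lemma coeff_seriesEmbedding (ρ : S →+* MvPolynomial (Fin n) ℚ) (f : PowerSeries S)
    (d : Fin (n + 1) →₀ ℕ) :
    MvPowerSeries.coeff d (seriesEmbedding ρ f) =
      (ρ (PowerSeries.coeff (d 0) f)).coeff d.tail := by
  conv_lhs => rw [← Finsupp.cons_tail d]
  rw [← MvPowerSeries.coeff_coeff_finSuccEquiv]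
  simp [seriesEmbedding]

lemma seriesEmbedding_coe (ρ : S →+* MvPolynomial (Fin n) ℚ) (p : Polynomial S) :
    seriesEmbedding ρ (p : PowerSeries S) = (polynomialEmbedding ρ p : MvPowerSeries _ ℚ) := by
  ext d
  rw [coeff_seriesEmbedding, MvPolynomial.coeff_coe, coeff_polynomialEmbedding,
    Polynomial.coeff_coe]

/-- The annihilating polynomial is transported coefficientwise and stays nonzero because `ρ` is
injective. -/
lemma isAlgebraicSeries_seriesEmbedding {ρ : S →+* MvPolynomial (Fin n) ℚ}
    (hρ : Function.Injective ρ) {f : PowerSeries S} (hf : IsAlgebraic (Polynomial S) f) :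
    IsAlgebraicSeries (seriesEmbedding ρ f) := by
  refine IsAlgebraic.ringHom_of_comp_eq (polynomialEmbedding ρ) (seriesEmbedding ρ) hf
    (polynomialEmbedding_injective hρ) (RingHom.ext fun p => ?_)
  simp only [RingHom.comp_apply, MvPowerSeries.algebraMap_apply', PowerSeries.algebraMap_apply',
    Algebra.algebraMap_self, PowerSeries.map_id, MvPowerSeries.map_id, RingHom.id_apply,
    seriesEmbedding_coe, RingHom.coe_coe, id_eq]

lemma IsAlgebraicSeries.rename {σ τ : Type*} [Finite σ] {e : σ → τ} (he : Function.Injective e)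
    {f : MvPowerSeries σ ℚ} (hf : IsAlgebraicSeries f) :
    IsAlgebraicSeries (MvPowerSeries.rename (R := ℚ) e f) := by
  refine IsAlgebraic.ringHom_of_comp_eq (MvPolynomial.rename (R := ℚ) e)
    (MvPowerSeries.rename (R := ℚ) e) hf (MvPolynomial.rename_injective e he)
    (RingHom.ext fun p => ?_)
  simp [RingHom.comp_apply, MvPowerSeries.algebraMap_apply', MvPowerSeries.rename_coe]

lemma coeff_rename_of_forall {σ τ : Type*} [Finite σ] {e : σ → τ} (he : Function.Injective e)
    (f : MvPowerSeries σ ℚ) {d : τ →₀ ℕ} {c : σ →₀ ℕ} (h : ∀ i, d (e i) = c i)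
    (h0 : ∀ j ∉ Set.range e, d j = 0) :
    MvPowerSeries.coeff d (MvPowerSeries.rename (R := ℚ) e f) = MvPowerSeries.coeff c f := by
  have : d = Finsupp.embDomain ⟨e, he⟩ c := by
    ext j
    by_cases hj : j ∈ Set.range e
    · obtain ⟨i, rfl⟩ := hj
      rw [h]
      exact (Finsupp.embDomain_apply_self ⟨e, he⟩ c i).symm
    · rw [h0 j hj, Finsupp.embDomain_of_notMem_range _ _ _ hj]
  rw [this]
  exact MvPowerSeries.coeff_embDomain_rename ⟨e, he⟩ f c

lemma coeff_rename_eq_zero_of_ne_zero {σ τ : Type*} [Finite σ] (e : σ → τ)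
    (f : MvPowerSeries σ ℚ) {d : τ →₀ ℕ} {i : τ} (hi : i ∉ Set.range e) (hd : d i ≠ 0) :
    MvPowerSeries.coeff d (MvPowerSeries.rename (R := ℚ) e f) = 0 := by
  refine MvPowerSeries.coeff_rename_eq_zero _ _ ?_
  rintro ⟨c, rfl⟩
  exact hd (Finsupp.mapDomain_of_notMem_range c i hi)

/-- The embedding `ℚ[z] → ℚ[z₀]`. -/
def embedding₁ : Polynomial ℚ →+* MvPolynomial (Fin 1) ℚ :=
  polynomialEmbedding (MvPolynomial.C (σ := Fin 0))

lemma embedding₁_injective : Function.Injective embedding₁ :=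
  polynomialEmbedding_injective (MvPolynomial.C_injective _ _)

lemma coeff_embedding₁ (p : Polynomial ℚ) (d : Fin 1 →₀ ℕ) :
    (embedding₁ p).coeff d = p.coeff (d 0) := by
  rw [embedding₁, coeff_polynomialEmbedding, MvPolynomial.coeff_C, if_pos (Subsingleton.elim _ _)]

/-- The embedding `ℚ[z₁][z₀] → ℚ[z₀, z₁]`. -/
def embedding₂ : Polynomial (Polynomial ℚ) →+* MvPolynomial (Fin 2) ℚ :=
  polynomialEmbedding embedding₁

lemma embedding₂_injective : Function.Injective embedding₂ :=
  polynomialEmbedding_injective embedding₁_injective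

lemma coeff_embedding₂ (p : Polynomial (Polynomial ℚ)) (d : Fin 2 →₀ ℕ) :
    (embedding₂ p).coeff d = (p.coeff (d 0)).coeff (d 1) := by
  rw [embedding₂, coeff_polynomialEmbedding, coeff_embedding₁]
  rfl

variable {A : Type*}

/-- The generating function of weighted walks on `ℕ`, with variables `length, endpoint, weight`. -/
def walkSeries₃ (steps : Finset A) (move : A → ℤ) (ω : A → Polynomial ℚ) :
    MvPowerSeries (Fin 3) ℚ :=
  seriesEmbedding embedding₂ (walkSeries steps move ω)

lemma coeff_walkSeries₃ (steps : Finset A) (move : A → ℤ) (ω : A → Polynomial ℚ)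
    (d : Fin 3 →₀ ℕ) : MvPowerSeries.coeff d (walkSeries₃ steps move ω) =
      (walkWeight steps move ω (d 0) (d 1)).coeff (d 2) := by
  rw [walkSeries₃, coeff_seriesEmbedding, coeff_embedding₂, walkSeries, PowerSeries.coeff_mk,
    coeff_walkPolynomial]
  rfl

lemma isAlgebraicSeries_walkSeries₃ (steps : Finset A) (move : A → ℤ) (ω : A → Polynomial ℚ) :
    IsAlgebraicSeries (walkSeries₃ steps move ω) :=
  isAlgebraicSeries_seriesEmbedding embedding₂_injective (isAlgebraic_walkSeries ω)

/-- The generating function of walks on `ℕ`, with variables `length, endpoint`. -/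
def walkSeries₂ (steps : Finset A) (move : A → ℤ) : MvPowerSeries (Fin 2) ℚ :=
  seriesEmbedding embedding₁ (walkSeries steps move fun _ => 1)

lemma coeff_walkSeries₂ (steps : Finset A) (move : A → ℤ) (d : Fin 2 →₀ ℕ) :
    MvPowerSeries.coeff d (walkSeries₂ steps move) =
      walkWeight steps move (fun _ => (1 : ℚ)) (d 0) (d 1) := by
  rw [walkSeries₂, coeff_seriesEmbedding, coeff_embedding₁, walkSeries, PowerSeries.coeff_mk,
    coeff_walkPolynomial]
  rfl

lemma isAlgebraicSeries_walkSeries₂ (steps : Finset A) (move : A → ℤ) :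
    IsAlgebraicSeries (walkSeries₂ steps move) :=
  isAlgebraicSeries_seriesEmbedding embedding₁_injective (isAlgebraic_walkSeries _)

/-- If `F` and `G` involve disjoint sets of variables, then the coefficients of `F * G` are the
products of the coefficients of `F` and `G`. -/
lemma coeff_mul_of_disjoint {σ : Type*} {F G : MvPowerSeries σ ℚ} (s : σ → Prop)
    [DecidablePred s] (hF : ∀ d i, ¬ s i → d i ≠ 0 → MvPowerSeries.coeff d F = 0)
    (hG : ∀ d i, s i → d i ≠ 0 → MvPowerSeries.coeff d G = 0) (d : σ →₀ ℕ) :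
    MvPowerSeries.coeff d (F * G) =
      MvPowerSeries.coeff (d.filter s) F * MvPowerSeries.coeff (d.filter fun i => ¬ s i) G := by
  classical
  rw [MvPowerSeries.coeff_mul]
  refine Finset.sum_eq_single_of_mem (d.filter s, d.filter fun i => ¬ s i) ?_ fun x hx hne => ?_
  · rw [Finset.HasAntidiagonal.mem_antidiagonal]
    exact Finsupp.filter_add_filter_not d s
  · rw [Finset.HasAntidiagonal.mem_antidiagonal] at hx
    by_contra h
    have h1 : ∀ i, ¬ s i → x.1 i = 0 := fun i hi => by
      by_contra h0
      exact h (by rw [hF _ i hi h0, zero_mul])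
    have h2 : ∀ i, s i → x.2 i = 0 := fun i hi => by
      by_contra h0
      exact h (by rw [hG _ i hi h0, mul_zero])
    refine hne (Prod.ext ?_ ?_)
    · ext i
      have := DFunLike.congr_fun hx i
      rw [Finsupp.add_apply] at this
      by_cases hi : s i
      · rw [Finsupp.filter_apply_pos _ _ hi, ← this, h2 i hi, add_zero]
      · rw [Finsupp.filter_apply_neg _ _ hi, h1 i hi]
    · ext i
      have := DFunLike.congr_fun hx i
      rw [Finsupp.add_apply] at this
      by_cases hi : s i
      · rw [Finsupp.filter_apply_neg (fun i => ¬ s i) _ (not_not.2 hi), h2 i hi]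
      · rw [Finsupp.filter_apply_pos (fun i => ¬ s i) _ hi, ← this, h1 i hi, zero_add]

end Transport

/-! ### Hadamard models, from Laurent polynomials to sets of steps. -/

section HadamardModel

/-- The steps in `S` are the steps `(u, 0)`, `u ∈ U`, and the steps `(v, t)`, `v ∈ V`, `t ∈ T`, the
two families being disjoint. -/
def IsHadamardModel (S : Finset (ℤ × ℤ)) (U V T : Finset ℤ) : Prop :=
  ∀ i j, (if (i, j) ∈ S then 1 else 0 : ℕ) =
    (if i ∈ U ∧ j = 0 then 1 else 0) + (if i ∈ V ∧ j ∈ T then 1 else 0)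

variable {S : Finset (ℤ × ℤ)} {U V T : Finset ℤ}

lemma IsHadamardModel.sum_eq (h : IsHadamardModel S U V T) {R : Type*} [AddCommMonoid R]
    (f : ℤ × ℤ → R) :
    ∑ s ∈ S, f s = ∑ u ∈ U, f (u, 0) + ∑ v ∈ V, ∑ t ∈ T, f (v, t) := by
  classical
  have hdisj : Disjoint (U ×ˢ {(0 : ℤ)}) (V ×ˢ T) := by
    rw [Finset.disjoint_left]
    rintro ⟨i, j⟩ h1 h2
    simp only [Finset.mem_product, Finset.mem_singleton] at h1 h2
    have := h i j
    rw [if_pos h1, if_pos h2] at this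
    split_ifs at this <;> omega
  have hS : S = (U ×ˢ {(0 : ℤ)}) ∪ (V ×ˢ T) := by
    ext ⟨i, j⟩
    have := h i j
    simp only [Finset.mem_union, Finset.mem_product, Finset.mem_singleton]
    split_ifs at this
    all_goals first | omega | tauto
  rw [hS, Finset.sum_union hdisj, Finset.sum_product, Finset.sum_product]
  simp

section LaurentCoefficients

variable {K : Type*} [Field K]

lemma coeff_stepPolynomial (S : Finset (ℤ × ℤ)) (i j : ℤ) :
    (stepPolynomial K S).coeff (i, j) = if (i, j) ∈ S then 1 else 0 := by
  classical
  rw [stepPolynomial, AddMonoidAlgebra.coeff_sum, Finsupp.finsetSum_apply]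
  simp [Finsupp.single_apply]

lemma coeff_generatingPolynomial (A : Finset ℤ) (i : ℤ) :
    (generatingPolynomial K A).coeff i = if i ∈ A then 1 else 0 := by
  classical
  rw [generatingPolynomial, AddMonoidAlgebra.coeff_sum, Finsupp.finsetSum_apply]
  simp only [LaurentPolynomial.T, AddMonoidAlgebra.coeff_single, Finsupp.single_apply,
    Finset.sum_ite_eq']

lemma coeff_inX (P : LaurentPolynomial K) (i j : ℤ) :
    (inX P).coeff (i, j) = if j = 0 then P.coeff i else 0 := by
  classical
  induction P using AddMonoidAlgebra.induction_linear with
  | zero => simp [inX]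
  | add p q hp hq =>
    have : inX (p + q) = inX p + inX q := map_add _ _ _
    rw [this, AddMonoidAlgebra.coeff_add, Finsupp.add_apply, hp, hq, AddMonoidAlgebra.coeff_add,
      Finsupp.add_apply]
    split_ifs <;> simp
  | single n a =>
    simp only [inX, AddMonoidAlgebra.mapDomainRingHom_apply, AddMonoidAlgebra.mapDomain_single,
      AddMonoidAlgebra.coeff_single, Finsupp.single_apply, AddMonoidHom.inl_apply, Prod.mk.injEq]
    split_ifs <;> simp_all

lemma coeff_inX_mul_inY (P Q : LaurentPolynomial K) (i j : ℤ) :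
    (inX P * inY Q).coeff (i, j) = P.coeff i * Q.coeff j := by
  classical
  induction P using AddMonoidAlgebra.induction_linear with
  | zero => simp [inX]
  | add p q hp hq =>
    have : inX (p + q) = inX p + inX q := map_add _ _ _
    rw [this, add_mul, AddMonoidAlgebra.coeff_add, Finsupp.add_apply, hp, hq,
      AddMonoidAlgebra.coeff_add, Finsupp.add_apply, add_mul]
  | single n a =>
    induction Q using AddMonoidAlgebra.induction_linear with
    | zero => simp [inY]
    | add p q hp hq =>
      have : inY (p + q) = inY p + inY q := map_add _ _ _
      rw [this, mul_add, AddMonoidAlgebra.coeff_add, Finsupp.add_apply, hp, hq,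
        AddMonoidAlgebra.coeff_add, Finsupp.add_apply, mul_add]
    | single m b =>
      simp only [inX, inY, AddMonoidAlgebra.mapDomainRingHom_apply,
        AddMonoidAlgebra.mapDomain_single, AddMonoidAlgebra.single_mul_single,
        AddMonoidAlgebra.coeff_single, Finsupp.single_apply, AddMonoidHom.inl_apply,
        AddMonoidHom.inr_apply, Prod.mk_add_mk, add_zero, zero_add, Prod.mk.injEq]
      split_ifs <;> simp_all

lemma coeff_eq_of_stepPolynomial_eq {P Q R : LaurentPolynomial K}
    (hS : stepPolynomial K S = inX P + inX Q * inY R) (i j : ℤ) :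
    (if (i, j) ∈ S then 1 else 0 : K) = (if j = 0 then P.coeff i else 0) + Q.coeff i * R.coeff j := by
  rw [← coeff_stepPolynomial, hS, AddMonoidAlgebra.coeff_add, Finsupp.add_apply, coeff_inX,
    coeff_inX_mul_inY]

/-- All coefficients are 0 or 1, so characteristic zero lifts the identity to `ℕ`, where it also
forces the two families to be disjoint. -/
lemma isHadamardModel_of_generatingPolynomial [CharZero K]
    (hS : stepPolynomial K S = inX (generatingPolynomial K U) +
      inX (generatingPolynomial K V) * inY (generatingPolynomial K T)) :
    IsHadamardModel S U V T := by
  intro i j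
  have h := coeff_eq_of_stepPolynomial_eq hS i j
  simp only [coeff_generatingPolynomial] at h
  apply Nat.cast_injective (R := K)
  push_cast
  rw [h]
  congr 1
  · split_ifs <;> simp_all
  · split_ifs <;> simp_all

/-- This reduces D-finiteness for arbitrary coefficients to sets of steps. Off the row `j = 0`,
membership in `S` means that both factors of `Q_i R_j` are nonzero; the whole row `j = 0` is put
into `U`. -/
lemma exists_isHadamardModel {P Q R : LaurentPolynomial K}
    (hS : stepPolynomial K S = inX P + inX Q * inY R) :
    ∃ U V T : Finset ℤ, IsHadamardModel S U V T := by
  classical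
  refine ⟨(S.filter fun s => s.2 = 0).image Prod.fst, Q.coeff.support, R.coeff.support.erase 0,
    fun i j => ?_⟩
  have h := coeff_eq_of_stepPolynomial_eq hS i j
  by_cases hj : j = 0
  · subst hj
    simp
  · rw [if_neg hj, zero_add] at h
    have hiff : (i, j) ∈ S ↔ Q.coeff i ≠ 0 ∧ R.coeff j ≠ 0 := by
      rw [← mul_ne_zero_iff, ← h]
      simp
    simp [hj, hiff]

end LaurentCoefficients

/-! ### Quadrant walks as merged horizontal and vertical walks. -/

section Counting

/-- The linear form on polynomials in `v` that replaces `v ^ m` by the number of walks on `ℕ` of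
length `m` that end at `j`. -/
def walkForm (T : Finset ℤ) (j : ℤ) : Polynomial ℚ →ₗ[ℚ] ℚ :=
  Polynomial.lsum fun m => LinearMap.mulRight ℚ (walkWeight T id (fun _ => (1 : ℚ)) m j)

lemma walkForm_monomial (T : Finset ℤ) (j : ℤ) (m : ℕ) (r : ℚ) :
    walkForm T j (Polynomial.monomial m r) = r * walkWeight T id (fun _ => (1 : ℚ)) m j := by
  simp [walkForm, Polynomial.lsum_apply]

lemma walkForm_eq_sum (T : Finset ℤ) (j : ℤ) {p : Polynomial ℚ} {n : ℕ} (hp : p.natDegree ≤ n) :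
    walkForm T j p = ∑ m ∈ Finset.range (n + 1),
      p.coeff m * walkWeight T id (fun _ => (1 : ℚ)) m j := by
  rw [walkForm, Polynomial.lsum_apply,
    Polynomial.sum_over_range' _ (by simp) (n + 1) (Nat.lt_succ_of_le hp)]
  rfl

/-- A factor `v` stands for one more vertical step, which is split off as the last one. -/
lemma walkForm_X_mul (T : Finset ℤ) {j : ℤ} (hj : 0 ≤ j) (p : Polynomial ℚ) :
    walkForm T j (Polynomial.X * p) = ∑ t ∈ T, walkForm T (j - t) p := by
  induction p using Polynomial.induction_on' with
  | add p q hp hq => simp only [mul_add, map_add, hp, hq, Finset.sum_add_distrib]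
  | monomial m r =>
    rw [Polynomial.X_mul_monomial, walkForm_monomial, walkWeight_succ, if_pos hj, Finset.mul_sum]
    refine Finset.sum_congr rfl fun t _ => ?_
    rw [walkForm_monomial, one_mul, id]

lemma walkForm_of_neg (T : Finset ℤ) {j : ℤ} (hj : ¬ 0 ≤ j) (p : Polynomial ℚ) :
    walkForm T j p = 0 := by
  induction p using Polynomial.induction_on' with
  | add p q hp hq => rw [map_add, hp, hq, add_zero]
  | monomial m r => rw [walkForm_monomial, walkWeight_of_not_nonneg _ _ _ _ hj, mul_zero]

/-- The weighted count of the walks on `ℕ` with steps in the multiset `U ∪ V`, each step in `V`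
being weighted by the variable. -/
def horizontalWeight (U V : Finset ℤ) (n : ℕ) (i : ℤ) : Polynomial ℚ :=
  walkWeight (U.disjSum V) (Sum.elim id id) (Sum.elim (fun _ => 1) fun _ => Polynomial.X) n i

/-- Quadrant walks of a Hadamard model, counted by merging horizontal and vertical walks. -/
lemma IsHadamardModel.walkWeight_eq (h : IsHadamardModel S U V T) (n : ℕ) (i j : ℤ) :
    walkWeight S id (fun _ => (1 : ℚ)) n (i, j) = walkForm T j (horizontalWeight U V n i) := by
  classical
  induction n generalizing i j with
  | zero =>
    rw [horizontalWeight, walkWeight_zero, walkWeight_zero]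
    by_cases hi : i = 0
    · rw [if_pos hi, ← Polynomial.monomial_zero_one, walkForm_monomial, walkWeight_zero, one_mul]
      simp [hi]
    · rw [if_neg hi, if_neg (by simp [hi]), map_zero]
  | succ n ih =>
    rw [walkWeight_succ, horizontalWeight, walkWeight_succ]
    have hle : (0 : ℤ × ℤ) ≤ (i, j) ↔ 0 ≤ i ∧ 0 ≤ j := Prod.mk_le_mk
    by_cases hj : 0 ≤ j
    · by_cases hi : 0 ≤ i
      · rw [if_pos (hle.2 ⟨hi, hj⟩), if_pos hi, h.sum_eq, Finset.sum_disjSum, map_add,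
          map_sum, map_sum]
        simp only [Sum.elim_inl, Sum.elim_inr, one_mul, id, Prod.mk_sub_mk, ih, sub_zero,
          walkForm_X_mul T hj, horizontalWeight]
      · rw [if_neg hi, if_neg (fun h => hi (hle.1 h).1), map_zero]
    · rw [walkForm_of_neg T hj, if_neg (fun h => hj (hle.1 h).2)]

lemma prod_elim_one_X {A B : Type*} {n : ℕ} (w : Fin n → A ⊕ B) :
    ∏ i, (Sum.elim (fun _ => 1) (fun _ => Polynomial.X) (w i) : Polynomial ℚ) =
      Polynomial.X ^ (Finset.univ.filter fun i => (w i).isRight).card := by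
  rw [← Finset.prod_const, Finset.prod_filter]
  refine Finset.prod_congr rfl fun i _ => ?_
  cases w i <;> rfl

lemma prod_elim_X_one {A B : Type*} {n : ℕ} (w : Fin n → A ⊕ B) :
    ∏ i, (Sum.elim (fun _ => Polynomial.X) (fun _ => 1) (w i) : Polynomial ℚ) =
      Polynomial.X ^ (n - (Finset.univ.filter fun i => (w i).isRight).card) := by
  have h : n - (Finset.univ.filter fun i => (w i).isRight).card =
      (Finset.univ.filter fun i => ¬ (w i).isRight).card := by
    have := Finset.card_filter_add_card_filter_not (s := (Finset.univ : Finset (Fin n)))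
      (fun i => (w i).isRight = true)
    rw [Finset.card_univ, Fintype.card_fin] at this
    omega
  rw [h, ← Finset.prod_const, Finset.prod_filter]
  refine Finset.prod_congr rfl fun i _ => ?_
  cases w i <;> rfl

lemma natDegree_horizontalWeight_le (U V : Finset ℤ) (n : ℕ) (i : ℤ) :
    (horizontalWeight U V n i).natDegree ≤ n := by
  refine Polynomial.natDegree_sum_le_of_forall_le _ _ fun w _ => ?_
  rw [prod_elim_one_X]
  refine (Polynomial.natDegree_X_pow_le _).trans ((Finset.card_filter_le _ _).trans ?_)
  simp

/-- Weighting the steps in `U` instead of those in `V` reverses the coefficients. -/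
lemma coeff_walkWeight_elim_X_one (U V : Finset ℤ) (n : ℕ) (i : ℤ) {k : ℕ} (hk : k ≤ n) :
    (walkWeight (U.disjSum V) (Sum.elim id id)
      (Sum.elim (fun _ => Polynomial.X) fun _ => (1 : Polynomial ℚ)) n i).coeff k =
        (horizontalWeight U V n i).coeff (n - k) := by
  simp only [horizontalWeight, walkWeight, Polynomial.finsetSum_coeff, prod_elim_one_X,
    prod_elim_X_one, Polynomial.coeff_X_pow]
  refine Finset.sum_congr rfl fun w _ => ?_
  have : (Finset.univ.filter fun i => (w i).isRight).card ≤ n :=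
    (Finset.card_filter_le _ _).trans (by simp)
  congr 1
  simp only [eq_iff_iff]
  omega

end Counting

/-! ### The Hadamard product formula and D-finiteness of `Q`. -/

section GeneratingFunctions

lemma coeff_quadrantGF (S : Finset (ℤ × ℤ)) (d : Fin 3 →₀ ℕ) :
    MvPowerSeries.coeff d (quadrantGF S) =
      walkWeight S id (fun _ => (1 : ℚ)) (d 2) ((d 0 : ℤ), (d 1 : ℤ)) := by
  change quadrantGF S d = _
  simp only [quadrantGF, walkWeight, Finset.prod_const_one, Finset.sum_const, nsmul_eq_mul, mul_one]
  congr

lemma coeff_horizontalGF (U V : Finset ℤ) (d : Fin 3 →₀ ℕ) :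
    MvPowerSeries.coeff d (horizontalGF U V) =
      (horizontalWeight U V (d 2) (d 1)).coeff (d 0) := by
  classical
  change horizontalGF U V d = _
  simp only [horizontalGF, horizontalWeight, walkWeight, Polynomial.finsetSum_coeff,
    prod_elim_one_X, Polynomial.coeff_X_pow, Finset.sum_boole, Finset.filter_filter]
  congr 3
  ext w
  simp only [eq_comm]

lemma horizontalGF_eq_rename (U V : Finset ℤ) :
    horizontalGF U V = MvPowerSeries.rename (R := ℚ) ![(2 : Fin 3), 1, 0]
      (walkSeries₃ (U.disjSum V) (Sum.elim id id)
        (Sum.elim (fun _ => 1) fun _ => Polynomial.X)) := by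
  ext d
  rw [coeff_horizontalGF, coeff_rename_of_forall (by decide) _
    (c := Finsupp.equivFunOnFinite.symm ![d 2, d 1, d 0]), coeff_walkSeries₃]
  · rfl
  · intro i
    fin_cases i <;> rfl
  · intro j hj
    exact absurd (by fin_cases j <;> simp) hj

lemma isAlgebraicSeries_horizontalGF (U V : Finset ℤ) : IsAlgebraicSeries (horizontalGF U V) := by
  rw [horizontalGF_eq_rename]
  exact (isAlgebraicSeries_walkSeries₃ _ _ _).rename (by decide)

lemma coeff_verticalGF (T : Finset ℤ) (d : Fin 2 →₀ ℕ) :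
    MvPowerSeries.coeff d (verticalGF T) = walkWeight T id (fun _ => (1 : ℚ)) (d 0) (d 1) := by
  change verticalGF T d = _
  simp only [verticalGF, walkWeight, Finset.prod_const_one, Finset.sum_const, nsmul_eq_mul, mul_one]
  congr

lemma isAlgebraicSeries_verticalGF (T : Finset ℤ) : IsAlgebraicSeries (verticalGF T) := by
  have : verticalGF T = walkSeries₂ T id := by
    ext d
    rw [coeff_verticalGF, coeff_walkSeries₂]
  rw [this]
  exact isAlgebraicSeries_walkSeries₂ T id

lemma coeff_hadamardProduct_expand (U V T : Finset ℤ) (m : ℕ) (d : Fin 3 →₀ ℕ) :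
    MvPowerSeries.coeff d (PowerSeries.coeff m
      (hadamardProduct (expandVXT (horizontalGF U V)) (expandVY (verticalGF T)))) =
        (horizontalWeight U V (d 2) (d 0)).coeff m *
          walkWeight T id (fun _ => (1 : ℚ)) m (d 1) := by
  rw [hadamardProduct, PowerSeries.coeff_mk, expandVXT, expandVY, PowerSeries.coeff_map,
    PowerSeries.coeff_map]
  simp only [AlgHom.toRingHom_eq_coe, RingHom.coe_coe]
  -- Variable `1` is `y`: the first factor involves only `x, t`, the second only `y`.
  rw [coeff_mul_of_disjoint (fun i => i ≠ 1)]
  · congr 1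
    · rw [coeff_rename_of_forall (by decide) _ (c := Finsupp.equivFunOnFinite.symm ![d 0, d 2]),
        MvPowerSeries.coeff_coeff_finSuccEquiv, coeff_horizontalGF]
      · rfl
      · intro i
        fin_cases i <;> exact Finsupp.filter_apply_pos _ _ (by decide)
      · intro j hj
        refine Finsupp.filter_apply_neg _ _ fun h => hj ?_
        fin_cases j <;> simp_all
    · rw [coeff_rename_of_forall (by decide) _ (c := Finsupp.equivFunOnFinite.symm ![d 1]),
        MvPowerSeries.coeff_coeff_finSuccEquiv, coeff_verticalGF]
      · rfl
      · intro i
        fin_cases i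
        exact Finsupp.filter_apply_pos (fun i : Fin 3 => ¬ i ≠ 1) _ (by decide)
      · intro j hj
        refine Finsupp.filter_apply_neg (fun i : Fin 3 => ¬ i ≠ 1) _ fun h => hj ?_
        fin_cases j <;> simp_all
  · intro d i hi hd
    refine coeff_rename_eq_zero_of_ne_zero _ _ ?_ hd
    rw [not_not.1 hi]
    decide
  · intro d i hi hd
    refine coeff_rename_eq_zero_of_ne_zero _ _ ?_ hd
    rintro ⟨j, rfl⟩
    fin_cases j
    exact hi rfl

/-- A walk of length `n` has at most `n` steps in `V`, so only the powers `v ^ m` with `m ≤ n`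
contribute. -/
theorem IsHadamardModel.hasEvalAtOne (h : IsHadamardModel S U V T) :
    HasEvalAtOne (hadamardProduct (expandVXT (horizontalGF U V)) (expandVY (verticalGF T)))
      (quadrantGF S) := by
  intro d
  simp only [coeff_hadamardProduct_expand]
  have hsub : ∀ m, (horizontalWeight U V (d 2) (d 0)).coeff m *
      walkWeight T id (fun _ => (1 : ℚ)) m (d 1) ≠ 0 → m ∈ Finset.range (d 2 + 1) := by
    intro m hm
    rw [Finset.mem_range]
    by_contra hlt
    refine hm ?_
    rw [Polynomial.coeff_eq_zero_of_natDegree_lt, zero_mul]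
    exact (natDegree_horizontalWeight_le U V _ _).trans_lt (by omega)
  refine ⟨(Finset.range (d 2 + 1)).finite_toSet.subset hsub, ?_⟩
  rw [coeff_quadrantGF, h.walkWeight_eq, walkForm_eq_sum T _ (natDegree_horizontalWeight_le U V _ _),
    finsum_eq_sum_of_support_subset _ hsub]

/-- The product of `C₁(x, 1 / w; t)` and `C₂(y; w)`, as a series in `τ, w, x, y` with `t = τ w`. -/
def mergedSeries (U V T : Finset ℤ) : MvPowerSeries (Fin 4) ℚ :=
  MvPowerSeries.rename (R := ℚ) ![(0 : Fin 4), 2, 1]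
    (walkSeries₃ (U.disjSum V) (Sum.elim id id) (Sum.elim (fun _ => Polynomial.X) fun _ => 1)) *
  MvPowerSeries.rename (R := ℚ) ![(1 : Fin 4), 3] (walkSeries₂ T id)

lemma isAlgebraicSeries_mergedSeries (U V T : Finset ℤ) :
    IsAlgebraicSeries (mergedSeries U V T) := by
  have : IsDomain (MvPowerSeries (Fin 4) ℚ) := NoZeroDivisors.to_isDomain _
  exact IsAlgebraic.mul ((isAlgebraicSeries_walkSeries₃ _ _ _).rename (by decide))
    ((isAlgebraicSeries_walkSeries₂ _ _).rename (by decide))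

lemma IsHadamardModel.slopeCoeff_mergedSeries (h : IsHadamardModel S U V T) :
    slopeCoeff 0 (mergedSeries U V T) = quadrantGF S := by
  classical
  ext e
  rw [coeff_slopeCoeff, coeff_quadrantGF, h.walkWeight_eq,
    walkForm_eq_sum T _ (natDegree_horizontalWeight_le U V _ _), mergedSeries,
    MvPowerSeries.coeff_mul, ← Finset.sum_range_reflect]
  symm
  -- After the reflection, `k` counts the `U`-steps. The exponent `e 2` of `w` splits into `k` from
  -- the horizontal factor and the length `e 2 - k` of the vertical walk; all other splittings
  -- contribute zero.
  refine Finset.sum_of_injOn (fun k => (Finsupp.equivFunOnFinite.symm ![e 2, k, e 0, 0],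
    Finsupp.equivFunOnFinite.symm ![0, e 2 - k, 0, e 1])) ?_ ?_ ?_ ?_
  · intro k _ l _ hkl
    exact DFunLike.congr_fun (Prod.ext_iff.1 hkl).1 1
  · intro k hk
    have hk : k ≤ e 2 := Nat.lt_succ_iff.1 (Finset.mem_range.1 hk)
    rw [Finset.mem_coe, Finset.HasAntidiagonal.mem_antidiagonal]
    ext i
    fin_cases i <;> simp
    omega
  · rintro ⟨a, b⟩ hab hne
    rw [Finset.HasAntidiagonal.mem_antidiagonal] at hab
    dsimp only at hab ⊢
    have hab' := fun i => DFunLike.congr_fun hab i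
    simp only [Finsupp.add_apply] at hab'
    by_cases ha : a 3 = 0
    · by_cases hb : b 0 = 0
      · by_cases hb' : b 2 = 0
        · refine absurd ⟨a 1, ?_, ?_⟩ hne
          · have := hab' 1
            simp only [slopeExponent_one] at this
            rw [Finset.mem_coe, Finset.mem_range]
            omega
          · have h0 := hab' 0
            have h1 := hab' 1
            have h2 := hab' 2
            have h3 := hab' 3
            simp only [slopeExponent_zero, slopeExponent_one, slopeExponent_two,
              slopeExponent_three] at h0 h1 h2 h3
            refine Prod.ext ?_ ?_
            · ext i
              fin_cases i <;> simp <;> omega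
            · ext i
              fin_cases i <;> simp <;> omega
        · rw [coeff_rename_eq_zero_of_ne_zero ![(1 : Fin 4), 3] _ (i := 2) (by decide) hb', mul_zero]
      · rw [coeff_rename_eq_zero_of_ne_zero ![(1 : Fin 4), 3] _ (i := 0) (by decide) hb, mul_zero]
    · rw [coeff_rename_eq_zero_of_ne_zero ![(0 : Fin 4), 2, 1] _ (i := 3) (by decide) ha, zero_mul]
  · intro k hk
    have hk : k ≤ e 2 := Nat.lt_succ_iff.1 (Finset.mem_range.1 hk)
    rw [coeff_rename_of_forall (by decide) _ (c := Finsupp.equivFunOnFinite.symm ![e 2, e 0, k]),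
      coeff_walkSeries₃,
      coeff_rename_of_forall (by decide) _ (c := Finsupp.equivFunOnFinite.symm ![e 2 - k, e 1]),
      coeff_walkSeries₂]
    · have : e 2 + 1 - 1 - k = e 2 - k := by omega
      rw [this]
      exact congrArg (· * _) (coeff_walkWeight_elim_X_one U V (e 2) (e 0) hk).symm
    · intro i
      fin_cases i <;> rfl
    · intro j hj
      fin_cases j <;> simp_all
    · intro i
      fin_cases i <;> rfl
    · intro j hj
      fin_cases j <;> simp_all

theorem IsHadamardModel.isDFinite (h : IsHadamardModel S U V T) : IsDFinite (quadrantGF S) := by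
  rw [← h.slopeCoeff_mergedSeries]
  exact isDFinite_slopeCoeff_zero (isAlgebraicSeries_mergedSeries U V T)

end GeneratingFunctions

end HadamardModel

end

theorem proposition6p1 {K : Type*} [Field K] [CharZero K]
    (S : Finset (ℤ × ℤ)) (U V T : LaurentPolynomial K)
    (hS : stepPolynomial K S = inX U + inX V * inY T) :
    (∀ setU setV setT : Finset ℤ,
      generatingPolynomial K setU = U → generatingPolynomial K setV = V →
      generatingPolynomial K setT = T →
        IsAlgebraicSeries (horizontalGF setU setV) ∧
        IsAlgebraicSeries (verticalGF setT) ∧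
        HasEvalAtOne
          (hadamardProduct (expandVXT (horizontalGF setU setV)) (expandVY (verticalGF setT)))
          (quadrantGF S)) ∧
    IsDFinite (quadrantGF S) := by
  refine ⟨?_, ?_⟩
  · rintro setU setV setT rfl rfl rfl
    exact ⟨isAlgebraicSeries_horizontalGF setU setV, isAlgebraicSeries_verticalGF setT,
      (isHadamardModel_of_generatingPolynomial hS).hasEvalAtOne⟩
  · obtain ⟨U', V', T', h⟩ := exists_isHadamardModel hS
    exact h.isDFinite
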